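/- Let $N\ge 0$ be an integer and let $\mathbf s=(s_i)_{i\in\mathbb Z}$, $s_i\in\{1,-1\}$, be a parity sequence with $s_{i+N}=s_i$ for all $i$ (for $N=0$ this is no condition, and $\mathbf s$ is arbitrary). Let $z_i$, $i\in\mathbb Z$, be commuting variables with $z_{i+N}=z_i$ and otherwise independent. For $i\le j$ put $|i|=(1-s_is_{i+1})/2$, $\sigma(i,j)=(-1)^{\sum_{t=i}^{j}|t|}$ and $z_{i,j}=\prod_{t=i}^{j}z_t$. Fix $k\in\mathbb Z$. A plane $\mathbf s$-partition with corner box of color $k$ is a sequence $(\boldsymbol\lambda^{(r)},\boldsymbol\mu^{(r)})_{r\ge 1}$ of pairs of finite weakly decreasing sequences of positive integers, almost all of them $(\emptyset,\emptyset)$, such that for all $r\ge1$: (a) $\ell(\boldsymbol\mu^{(r)})\le\ell(\boldsymbol\lambda^{(r)})$, where $\ell$ is the number of parts; an equality of consecutive parts $\lambda^{(r)}_i=\lambda^{(r)}_{i+1}$ is allowed only if $s_{k+\lambda^{(r)}_i}=s_k$, and $\mu^{(r)}_i=\mu^{(r)}_{i+1}$ only if $s_{k-\mu^{(r)}_i}=s_k$;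 (b) $\ell(\boldsymbol\lambda^{(r+1)})\le\ell(\boldsymbol\mu^{(r)})$, $\ell(\boldsymbol\lambda^{(r+1)})\le\ell(\boldsymbol\lambda^{(r)})$ and $\ell(\boldsymbol\mu^{(r+1)})\le\ell(\boldsymbol\mu^{(r)})$; for $1\le i\le\ell(\boldsymbol\lambda^{(r+1)})$, $\lambda^{(r)}_i\ge\lambda^{(r+1)}_i$, with equality allowed only if $s_{k+\lambda^{(r)}_i}=-s_k$; for $1\le i\le\ell(\boldsymbol\mu^{(r+1)})$, $\mu^{(r)}_i\ge\mu^{(r+1)}_i$, with equality allowed only if $s_{k-\mu^{(r)}_i}=-s_k$. Each part $a$ of some $\boldsymbol\lambda^{(r)}$ is a row of $a$ boxes of colors $k,k+1,\dots,k+a-1$, and each part $b$ of some $\boldsymbol\mu^{(r)}$ is a column of $b$ boxes of colors $k-1,k-2,\dots,k-b$, where colors are taken modulo $N$. The degree of a plane $\mathbf s$-partition is the product of $z_i$ over its boxes, $i$ being the color of the box. For $L_1,L_2\in\mathbb Z_{\ge0}$ it is called $L_1\times L_2$ restricted if $\lambda^{(1)}_1\le L_1$ and $\mu^{(1)}_1\le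 L_2$ (the first part of $\emptyset$ being $0$). Theorem. For every monomial in the $z_i$ there are only finitely many $L_1\times L_2$ restricted plane $\mathbf s$-partitions of that degree, and their generating function $\chi_{L_1,L_2}$, the sum of their degrees, is, as a formal power series, $$\chi_{L_1,L_2}=\prod_{k-L_2\le i\le k}\ \prod_{k\le j\le k+L_1-1}\bigl(1-\sigma(i,j)z_{i,j}\bigr)^{-\sigma(i,j)} ,$$ the product being $1$ when $L_1=0$. -/

import Mathlib

/-! Throughout, a parity sequence is a function `s : ℤ → ℤˣ`, i.e. a two-sided sequence of signs,
and colors are elements of `ZMod N`; for `N = 0` this is `ℤ`, so that all colors are distinct. -/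

/-- A finite sequence of positive integers which is weakly decreasing, where two neighbouring parts
may both be equal to `a` if and only if `t a = ε`. For `t a = s a` (resp. `t a = s (-a)`) and `ε = ±1`
these are the `s^±_+`-partitions (resp. the `s^±_-`-partitions). -/
def IsSignedPartition (t : ℕ → ℤˣ) (ε : ℤˣ) (l : List ℕ) : Prop :=
  (∀ a ∈ l, 0 < a) ∧ l.IsChain (fun a b => b < a ∨ (b = a ∧ t a = ε))

/-- The relation `(l₁, m₁) ≥_k (l₂, m₂)` between pairs of partitions, for the parity sequence `s`. -/
def PairGE (s : ℤ → ℤˣ) (k : ℤ) (l₁ m₁ l₂ m₂ : List ℕ) : Prop :=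
  l₂.length ≤ m₁.length ∧ l₂.length ≤ l₁.length ∧ m₂.length ≤ m₁.length ∧
  (∀ i < l₂.length, l₂.getD i 0 < l₁.getD i 0 ∨
    (l₂.getD i 0 = l₁.getD i 0 ∧
      (s (((l₁.getD i 0 : ℕ) : ℤ) + k) = -s k ∨ l₁.getD i 0 = 0))) ∧
  (∀ i < m₂.length, m₂.getD i 0 < m₁.getD i 0 ∨
    (m₂.getD i 0 = m₁.getD i 0 ∧
      (s (-((m₁.getD i 0 : ℕ) : ℤ) + k) = -s k ∨ m₁.getD i 0 = 0)))

/-- Plane `s`-partitions whose corner box has color `k`: sequences of layers `(lam r, mu r)`,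
`r = 0, 1, 2, …` (the bottom layer is `r = 0`), almost all of them empty. -/
structure PlaneSPartition (s : ℤ → ℤˣ) (k : ℤ) where
  lam : ℕ → List ℕ
  mu : ℕ → List ℕ
  lam_partition : ∀ r, IsSignedPartition (fun a => s (k + (a : ℤ))) (s k) (lam r)
  mu_partition : ∀ r, IsSignedPartition (fun a => s (k - (a : ℤ))) (s k) (mu r)
  length_mu_le : ∀ r, (mu r).length ≤ (lam r).length
  layers_ge : ∀ r, PairGE s k (lam r) (mu r) (lam (r + 1)) (mu (r + 1))
  finite_layers : {r | ¬ (lam r = [] ∧ mu r = [])}.Finite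

/-- The numbers of boxes of each color in a layer `(l, m)`. A part `a` of `l` is a row of `a` boxes
of colors `k, k + 1, …, k + a - 1`, starting on the main diagonal; a part `b` of `m` is a column of
`b` boxes of colors `k - 1, k - 2, …, k - b`, strictly below the main diagonal. -/
noncomputable def layerBoxes (N : ℕ) (k : ℤ) (l m : List ℕ) : ZMod N →₀ ℕ :=
  (l.map fun a => ∑ x ∈ Finset.range a, Finsupp.single ((k + (x : ℤ) : ℤ) : ZMod N) 1).sum +
  (m.map fun b => ∑ x ∈ Finset.range b, Finsupp.single ((k - 1 - (x : ℤ) : ℤ) : ZMod N) 1).sum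

namespace PlaneSPartition

variable {s : ℤ → ℤˣ} {k : ℤ}

/-- The exponent `c` of the degree `∏ i, z_i ^ c_i`, where `c_i` is the number of boxes of color
`i` (only finitely many terms of the sum are non-zero). -/
noncomputable def deg (N : ℕ) (P : PlaneSPartition s k) : ZMod N →₀ ℕ :=
  ∑ᶠ r, layerBoxes N k (P.lam r) (P.mu r)

/-- The first part of `lam` (resp. `mu`) in the bottom layer is at most `L₁` (resp. `L₂`); the first
part of the empty partition is `0`. -/
def IsRestricted (L₁ L₂ : ℕ) (P : PlaneSPartition s k) : Prop :=
  (P.lam 0).headD 0 ≤ L₁ ∧ (P.mu 0).headD 0 ≤ L₂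

end PlaneSPartition

/-- The `L₁ × L₂` restricted plane `s`-partitions of degree `∏ i, z_i ^ c_i`. -/
def restrictedOfDegree (N : ℕ) (s : ℤ → ℤˣ) (k : ℤ) (L₁ L₂ : ℕ) (c : ZMod N →₀ ℕ) :
    Set (PlaneSPartition s k) :=
  {P | P.IsRestricted L₁ L₂ ∧ P.deg N = c}

/-- The generating function `χ_{L₁,L₂}`, as a formal power series in the `z_i`: its coefficient at a
monomial is the number of restricted plane `s`-partitions with that degree. -/
noncomputable def restrictedGenFun (N : ℕ) (s : ℤ → ℤˣ) (k : ℤ) (L₁ L₂ : ℕ) :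
    MvPowerSeries (ZMod N) ℚ :=
  fun c => ((restrictedOfDegree N s k L₁ L₂ c).ncard : ℚ)

/-- The parity `|i| = (1 - s_i s_{i+1}) / 2 ∈ {0, 1}` (the division is exact). -/
def nodeParity (s : ℤ → ℤˣ) (i : ℤ) : ℤ := (1 - (s i : ℤ) * (s (i + 1) : ℤ)) / 2

/-- `σ(i,j) = (-1) ^ (|i| + |i+1| + ⋯ + |j|)`. -/
noncomputable def rootSign (s : ℤ → ℤˣ) (i j : ℤ) : ℤˣ := (-1) ^ (∑ t ∈ Finset.Icc i j, nodeParity s t)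

/-- `z_{i,j} = z_i z_{i+1} ⋯ z_j`, with the indices of the variables read modulo `N`. -/
noncomputable def zRoot (N : ℕ) (i j : ℤ) : MvPowerSeries (ZMod N) ℚ :=
  ∏ t ∈ Finset.Icc i j, MvPowerSeries.X ((t : ℤ) : ZMod N)

/-- `f ^ ε` for an exponent `ε = ±1`. -/
noncomputable def signPow {τ : Type} (f : MvPowerSeries τ ℚ) (ε : ℤˣ) : MvPowerSeries τ ℚ :=
  if ε = 1 then f else f⁻¹

/-! The positions (r, i) of the parts λ^(r)_i > a form a Young diagram, and likewise for μ. The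
rules on equal parts say that the cells between successive level sets form a horizontal or a
vertical strip, according to the sign s_{k±a} s_k of the value a they carry. The length conditions
say that the positions of the λ-parts and those of the μ-parts also differ by a horizontal strip. So
a restricted plane s-partition is a pair of chains of strips, with L₂ + 1 and L₁ steps, descending
to ∅ from a common diagram (`exists_equiv_chainPair`).

Summing over such pairs is the Cauchy identity for hook Schur functions (`sumAll_chainSum_mul`). It
follows from one commutation relation between adding and removing a strip
(`sumAll_stripWeight_mul`), with factor 1/(1 - xy) for equal types and 1 + xy for different ones;
this relation is proved bijectively by local rules of RSK type (`hasGrowth`). By Abel summation the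
degree becomes a product of strip weights, for which the product of the i-th and the j-th weight is
z_{k-i,k+j}, while the product of the two types is σ(k-i,k+j).

All sums are taken with coefficients in [0, ∞], where they always exist and may be rearranged. Since
the resulting product has natural coefficients, finiteness of the counts comes out at the end. -/

namespace YoungDiagram

/-! ### Young diagrams through their row lengths -/

/-- The Young diagram with prescribed row lengths. -/
def ofRowFun (f : ℕ → ℕ) (hf : Antitone f) (n : ℕ) (_ : f n = 0) : YoungDiagram where
  cells := (Finset.range n ×ˢ Finset.range (f 0)).filter fun c => c.2 < f c.1
  isLowerSet := by
    intro a b hab ha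
    have h1 : b.1 ≤ a.1 := hab.1
    have h2 : b.2 ≤ a.2 := hab.2
    have h3 := hf h1
    simp only [Finset.coe_filter, Finset.mem_product, Finset.mem_range, Set.mem_ofPred_eq] at ha ⊢
    omega

theorem mem_ofRowFun {f : ℕ → ℕ} (hf : Antitone f) {n : ℕ} (hn : f n = 0) {i j : ℕ} :
    (i, j) ∈ ofRowFun f hf n hn ↔ j < f i := by
  rw [← mem_cells]
  simp only [ofRowFun, Finset.mem_filter, Finset.mem_product, Finset.mem_range]
  refine ⟨fun h => h.2, fun h => ⟨⟨?_, h.trans_le (hf (Nat.zero_le i))⟩, h⟩⟩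
  by_contra hi
  have := hf (not_lt.mp hi)
  omega

theorem rowLen_ofRowFun {f : ℕ → ℕ} (hf : Antitone f) {n : ℕ} (hn : f n = 0) (i : ℕ) :
    (ofRowFun f hf n hn).rowLen i = f i := by
  apply eq_of_forall_lt_iff
  intro j
  rw [← mem_iff_lt_rowLen, mem_ofRowFun]

theorem ext_rowLen {μ ν : YoungDiagram} (h : ∀ i, μ.rowLen i = ν.rowLen i) : μ = ν := by
  apply SetLike.ext
  rintro ⟨i, j⟩
  rw [mem_iff_lt_rowLen, mem_iff_lt_rowLen, h]

theorem rowLen_eq_zero {μ : YoungDiagram} {i : ℕ} (h : μ.colLen 0 ≤ i) : μ.rowLen i = 0 := by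
  by_contra h0
  have : (i, 0) ∈ μ := mem_iff_lt_rowLen.mpr (Nat.pos_of_ne_zero h0)
  rw [mem_iff_lt_colLen] at this
  omega

theorem card_eq_sum_rowLen (μ : YoungDiagram) {n : ℕ} (hn : μ.colLen 0 ≤ n) :
    μ.card = ∑ i ∈ Finset.range n, μ.rowLen i := by
  rw [YoungDiagram.card, Finset.card_eq_sum_card_fiberwise (f := Prod.fst) (t := Finset.range n)]
  · refine Finset.sum_congr rfl fun i _ => ?_
    rw [rowLen_eq_card]
    rfl
  · rintro ⟨i, j⟩ h
    have h' : (i, 0) ∈ μ := μ.up_left_mem le_rfl (Nat.zero_le j) h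
    rw [mem_iff_lt_colLen] at h'
    simpa using h'.trans_le hn

/-- The rowwise identities telescope: `τ i` is a carry entering row i and `τ (i + 1)` the carry
leaving it, so only `τ 0` survives. -/
theorem card_add_card_eq {α β κ ν : YoungDiagram} {τ : ℕ → ℕ} {n : ℕ} (hτ : ∀ i, n ≤ i → τ i = 0)
    (h : ∀ i, ν.rowLen i + κ.rowLen i + τ (i + 1) = α.rowLen i + β.rowLen i + τ i) :
    ν.card + κ.card = α.card + β.card + τ 0 := by
  have key : ∀ m, (∑ i ∈ Finset.range m, ν.rowLen i) + (∑ i ∈ Finset.range m, κ.rowLen i) + τ m =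
      (∑ i ∈ Finset.range m, α.rowLen i) + (∑ i ∈ Finset.range m, β.rowLen i) + τ 0 := by
    intro m
    induction m with
    | zero => simp
    | succ m ih =>
      simp only [Finset.sum_range_succ]
      have := h m
      omega
  have := key (n + α.colLen 0 + β.colLen 0 + κ.colLen 0 + ν.colLen 0)
  rw [hτ _ (by omega), ← card_eq_sum_rowLen _ (by omega), ← card_eq_sum_rowLen _ (by omega),
    ← card_eq_sum_rowLen _ (by omega), ← card_eq_sum_rowLen _ (by omega)] at this
  exact this

theorem card_transpose (μ : YoungDiagram) : μ.transpose.card = μ.card := by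
  simp only [YoungDiagram.card, transpose, Equiv.finsetCongr_apply, Finset.card_map]

/-! ### Horizontal and vertical strips -/

/-- `ν / κ` is a strip: no two of its cells lie in the same column (for `t = 1`), or in the same
row (for `t = -1`). -/
def Strip (t : ℤˣ) (κ ν : YoungDiagram) : Prop :=
  κ ≤ ν ∧ if t = 1 then ∀ r i, (r + 1, i) ∈ ν → (r, i) ∈ κ else ∀ r i, (r, i + 1) ∈ ν → (r, i) ∈ κ

theorem le_iff_rowLen {κ ν : YoungDiagram} : κ ≤ ν ↔ ∀ r, κ.rowLen r ≤ ν.rowLen r := by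
  constructor
  · intro h r
    by_contra hr
    have h1 : (r, ν.rowLen r) ∈ ν := h (mem_iff_lt_rowLen.mpr (not_le.mp hr))
    exact lt_irrefl _ (mem_iff_lt_rowLen.mp h1)
  · rintro h ⟨i, j⟩ hc
    exact mem_iff_lt_rowLen.mpr ((mem_iff_lt_rowLen.mp hc).trans_le (h i))

theorem strip_one_iff {κ ν : YoungDiagram} :
    Strip 1 κ ν ↔ ∀ r, κ.rowLen r ≤ ν.rowLen r ∧ ν.rowLen (r + 1) ≤ κ.rowLen r := by
  simp only [Strip, if_true, le_iff_rowLen, mem_iff_lt_rowLen, forall_and]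
  exact and_congr_right fun _ => forall_congr' fun r => forall_lt_iff_le

theorem strip_neg_one_iff {κ ν : YoungDiagram} :
    Strip (-1) κ ν ↔ ∀ r, κ.rowLen r ≤ ν.rowLen r ∧ ν.rowLen r ≤ κ.rowLen r + 1 := by
  have : (-1 : ℤˣ) ≠ 1 := by decide
  simp only [Strip, if_neg this, le_iff_rowLen, mem_iff_lt_rowLen, forall_and]
  refine and_congr_right fun _ => forall_congr' fun r => ⟨fun h => ?_, fun h i hi => by omega⟩
  by_contra hr
  have := h (κ.rowLen r) (by omega)
  omega

theorem Strip.le {t : ℤˣ} {κ ν : YoungDiagram} (h : Strip t κ ν) : κ ≤ ν := h.1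

theorem Strip.card_le {t : ℤˣ} {κ ν : YoungDiagram} (h : Strip t κ ν) : κ.card ≤ ν.card :=
  Finset.card_le_card (cells_subset_iff.mpr h.1)

theorem strip_transpose {t : ℤˣ} {κ ν : YoungDiagram} :
    Strip (-t) κ.transpose ν.transpose ↔ Strip t κ ν := by
  have : (-1 : ℤˣ) ≠ 1 := by decide
  rcases Int.units_eq_one_or t with rfl | rfl <;>
    simp only [Strip, transpose_le_iff, mem_transpose, Prod.swap_prod_mk, neg_neg, if_true,
      if_neg this] <;>
    exact and_congr_right fun _ => forall_comm

/-- The bijections below are given by relations symmetric in both sides, so that existence and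
uniqueness in each direction become separate checks. -/
theorem exists_equiv_of_rel {A B : Type*} (R : A → B → Prop) (h1 : ∀ a, ∃ b, R a b)
    (h2 : ∀ b, ∃ a, R a b) (h3 : ∀ a b b', R a b → R a b' → b = b')
    (h4 : ∀ a a' b, R a b → R a' b → a = a') : ∃ e : A ≃ B, ∀ a, R a (e a) := by
  choose f hf using h1
  choose g hg using h2
  exact ⟨⟨f, g, fun a => h4 _ _ _ (hg _) (hf a), fun b => h3 _ _ _ (hf _) (hg b)⟩, hf⟩

/-! ### Local growth bijections -/

/-- The bijection behind the commutation relation of the operators which add a strip of type `t`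
and remove a strip of type `t'`. -/
def HasGrowth (t t' : ℤˣ) (α β : YoungDiagram) : Prop :=
  ∃ e : {ν // Strip t α ν ∧ Strip t' β ν} ≃
      {m : ℕ // t ≠ t' → m ≤ 1} × {κ // Strip t' κ α ∧ Strip t κ β},
    ∀ ν, ν.1.card + (e ν).2.1.card = α.card + β.card + (e ν).1.1

/-- Both ν_{i+1} and κ_i range independently over the interval from max(α_{i+1}, β_{i+1}) to
min(α_i, β_i), so reflecting this interval exchanges them. Only ν_0 is unbounded above; its excess
over max(α_0, β_0) is m. -/
theorem hasGrowth_one_one (α β : YoungDiagram) : HasGrowth 1 1 α β := by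
  refine Exists.elim (exists_equiv_of_rel
    (A := {ν // Strip 1 α ν ∧ Strip 1 β ν})
    (B := {m : ℕ // (1 : ℤˣ) ≠ 1 → m ≤ 1} × {κ // Strip 1 κ α ∧ Strip 1 κ β})
    (fun ν p => ν.1.rowLen 0 = p.1.1 + max (α.rowLen 0) (β.rowLen 0) ∧
      ∀ i, ν.1.rowLen (i + 1) + p.2.1.rowLen i =
        min (α.rowLen i) (β.rowLen i) + max (α.rowLen (i + 1)) (β.rowLen (i + 1)))
    ?_ ?_ ?_ ?_) ?_
  pick_goal 5
  · refine fun e he => ⟨e, fun ν => ?_⟩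
    obtain ⟨h0, h1⟩ := he ν
    have hν := ν.2
    rw [strip_one_iff, strip_one_iff] at hν
    have := card_add_card_eq (α := α) (β := β) (κ := (e ν).2.1) (ν := ν.1)
      (τ := fun i => ν.1.rowLen i - max (α.rowLen i) (β.rowLen i)) (n := ν.1.colLen 0)
      (fun i hi => by simp [rowLen_eq_zero hi]) (fun i => by
        have := h1 i
        have := hν.1 i
        have := hν.2 i
        have := hν.1 (i + 1)
        have := hν.2 (i + 1)
        omega)
    omega
  · rintro ⟨ν, hα, hβ⟩
    rw [strip_one_iff] at hα hβ
    refine ⟨⟨⟨ν.rowLen 0 - max (α.rowLen 0) (β.rowLen 0), by simp⟩, ofRowFun (fun i =>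
      min (α.rowLen i) (β.rowLen i) + max (α.rowLen (i + 1)) (β.rowLen (i + 1)) -
        ν.rowLen (i + 1)) (antitone_nat_of_succ_le fun i => ?_) (α.colLen 0 + β.colLen 0) ?_,
        ?_, ?_⟩, ?_, fun i => ?_⟩
    · have := hα (i + 1); have := hβ (i + 1); have := hα i; have := hβ i
      have := hα (i + 2); have := hβ (i + 2)
      simp only [add_assoc, Nat.reduceAdd] at *
      omega
    · rw [rowLen_eq_zero (μ := α) (by omega), rowLen_eq_zero (μ := β) (by omega),
        rowLen_eq_zero (μ := α) (by omega), rowLen_eq_zero (μ := β) (by omega)]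
      simp
    · rw [strip_one_iff]
      intro i
      rw [rowLen_ofRowFun]
      have := hα (i + 1); have := hβ (i + 1); have := hα i; have := hβ i
      omega
    · rw [strip_one_iff]
      intro i
      rw [rowLen_ofRowFun]
      have := hα (i + 1); have := hβ (i + 1); have := hα i; have := hβ i
      omega
    · have := hα 0; have := hβ 0
      dsimp only
      omega
    · rw [rowLen_ofRowFun]
      dsimp only
      have := hα (i + 1); have := hβ (i + 1); have := hα i; have := hβ i
      omega
  · rintro ⟨⟨m, hm⟩, κ, hα, hβ⟩
    rw [strip_one_iff] at hα hβ
    obtain ⟨f, hf0, hfs⟩ : ∃ f : ℕ → ℕ, f 0 = m + max (α.rowLen 0) (β.rowLen 0) ∧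
        ∀ i, f (i + 1) = min (α.rowLen i) (β.rowLen i) +
          max (α.rowLen (i + 1)) (β.rowLen (i + 1)) - κ.rowLen i :=
      ⟨fun i => Nat.casesOn i (m + max (α.rowLen 0) (β.rowLen 0)) fun i =>
        min (α.rowLen i) (β.rowLen i) + max (α.rowLen (i + 1)) (β.rowLen (i + 1)) - κ.rowLen i,
        rfl, fun _ => rfl⟩
    refine ⟨⟨ofRowFun f (antitone_nat_of_succ_le fun i => ?_) (α.colLen 0 + β.colLen 0 + 1) ?_,
        ?_, ?_⟩, ?_, fun i => ?_⟩
    · rcases i with _ | i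
      · have := hα 0; have := hβ 0; have := hfs 0
        omega
      · have := hα (i + 1); have := hβ (i + 1); have := hα i; have := hβ i
        have := hfs i; have := hfs (i + 1)
        omega
    · rw [hfs, rowLen_eq_zero (μ := α) (by omega), rowLen_eq_zero (μ := β) (by omega),
        rowLen_eq_zero (μ := α) (by omega), rowLen_eq_zero (μ := β) (by omega)]
      simp
    · rw [strip_one_iff]
      intro i
      rw [rowLen_ofRowFun, rowLen_ofRowFun]
      rcases i with _ | i
      · have := hα 0; have := hβ 0; have := hfs 0
        omega
      · have := hα (i + 1); have := hβ (i + 1); have := hα i; have := hβ i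
        have := hfs i; have := hfs (i + 1)
        omega
    · rw [strip_one_iff]
      intro i
      rw [rowLen_ofRowFun, rowLen_ofRowFun]
      rcases i with _ | i
      · have := hα 0; have := hβ 0; have := hfs 0
        omega
      · have := hα (i + 1); have := hβ (i + 1); have := hα i; have := hβ i
        have := hfs i; have := hfs (i + 1)
        omega
    · rw [rowLen_ofRowFun]
      exact hf0
    · rw [rowLen_ofRowFun]
      have := hα i; have := hβ i; have := hfs i
      dsimp only
      omega
  · rintro ⟨ν, hν⟩ ⟨⟨m, hm⟩, κ, hκ⟩ ⟨⟨m', hm'⟩, κ', hκ'⟩ ⟨h0, h1⟩ ⟨h0', h1'⟩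
    dsimp only at *
    obtain rfl : m = m' := by omega
    obtain rfl : κ = κ' := ext_rowLen fun i => by
      have := h1 i; have := h1' i
      omega
    rfl
  · rintro ⟨ν, hν⟩ ⟨ν', hν'⟩ ⟨⟨m, hm⟩, κ, hκ⟩ ⟨h0, h1⟩ ⟨h0', h1'⟩
    dsimp only at *
    obtain rfl : ν = ν' := ext_rowLen fun i => by
      rcases i with _ | i
      · omega
      · have := h1 i; have := h1' i
        omega
    rfl

/-- The recursion runs downwards in i: where `Q` fails, the value is copied from the next index, and
`Q` holds from `n` on. -/
theorem exists_next_value (Q : ℕ → Prop) (e : ℕ → ℕ) (n : ℕ) (hQ : ∀ i, n ≤ i → Q i) :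
    ∃ τ : ℕ → ℕ, ∀ i, (Q i → τ i = e i) ∧ (¬ Q i → τ i = τ (i + 1)) := by
  induction n generalizing Q e with
  | zero => exact ⟨e, fun i => ⟨fun _ => rfl, fun h => absurd (hQ i (Nat.zero_le i)) h⟩⟩
  | succ n ih =>
    obtain ⟨τ, hτ⟩ := ih (fun i => Q (i + 1)) (fun i => e (i + 1)) fun i hi => hQ _ (by omega)
    classical
    refine ⟨fun i => Nat.casesOn i (if Q 0 then e 0 else τ 0) τ, fun i => ?_⟩
    rcases i with _ | i
    · exact ⟨fun h => if_pos h, fun h => if_neg h⟩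
    · exact hτ i

/-- A carry τ_i ∈ {0, 1} passes through the rows, starting with τ_0 = m. If α_i ≤ β_i, the incoming
carry is ν_i - β_i and the outgoing one is α_i - κ_i. If α_i > β_i, then ν_i = α_i = β_i + 1 and κ_i
= β_i are forced, and the carry moves on unchanged. -/
theorem hasGrowth_one_neg_one (α β : YoungDiagram) : HasGrowth 1 (-1) α β := by
  have hne : (1 : ℤˣ) ≠ -1 := by decide
  have ha := fun i => α.rowLen_anti i (i + 1) (Nat.le_succ i)
  have hb := fun i => β.rowLen_anti i (i + 1) (Nat.le_succ i)
  have hQ : ∀ i, α.colLen 0 ≤ i → α.rowLen i ≤ β.rowLen i := fun i hi => by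
    rw [rowLen_eq_zero hi]
    exact Nat.zero_le _
  refine Exists.elim (exists_equiv_of_rel
    (A := {ν // Strip 1 α ν ∧ Strip (-1) β ν})
    (B := {m : ℕ // (1 : ℤˣ) ≠ -1 → m ≤ 1} × {κ // Strip (-1) κ α ∧ Strip 1 κ β})
    (fun ν p => ∃ τ : ℕ → ℕ, τ 0 = p.1.1 ∧ (∀ i, τ i ≤ 1) ∧
      ∀ i, (α.rowLen i ≤ β.rowLen i → ν.1.rowLen i = β.rowLen i + τ i ∧
          p.2.1.rowLen i + τ (i + 1) = α.rowLen i) ∧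
        (¬ α.rowLen i ≤ β.rowLen i → τ i = τ (i + 1)))
    ?_ ?_ ?_ ?_) ?_
  pick_goal 5
  · refine fun e he => ⟨e, fun ν => ?_⟩
    obtain ⟨τ, h0, -, h1⟩ := he ν
    have hν := ν.2
    have hκ := (e ν).2.2
    rw [strip_one_iff, strip_neg_one_iff] at hν hκ
    rw [← h0]
    -- Below the last row of α the outgoing carry is at most α_i = 0.
    refine card_add_card_eq (n := α.colLen 0 + 1) (fun i hi => ?_) (fun i => ?_)
    · obtain ⟨j, rfl⟩ := Nat.exists_eq_add_of_le' hi
      have := (h1 (j + α.colLen 0)).1 (hQ _ (by omega))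
      rw [rowLen_eq_zero (μ := α) (by omega)] at this
      rw [← add_assoc]
      omega
    · have := h1 i
      have := hν.1 i
      have := hν.2 i
      have := hκ.1 i
      have := hκ.2 i
      omega
  · rintro ⟨ν, hα, hβ⟩
    rw [strip_one_iff] at hα
    rw [strip_neg_one_iff] at hβ
    obtain ⟨τ, hτ⟩ := exists_next_value (fun i => α.rowLen i ≤ β.rowLen i)
      (fun i => ν.rowLen i - β.rowLen i) (α.colLen 0) hQ
    have hτ1 : ∀ i, τ i ≤ 1 := by
      -- Read off from ν, the carry is determined from the bottom row upwards, hence the induction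
      -- on the distance `d`.
      have : ∀ d i, α.colLen 0 ≤ i + d → τ i ≤ 1 := by
        intro d
        induction d with
        | zero =>
          intro i hi
          have := (hτ i).1 (hQ i hi)
          have := hβ i
          omega
        | succ d ih =>
          intro i hi
          have := ih (i + 1) (by omega)
          have := hτ i
          have := hβ i
          omega
      exact fun i => this _ i (Nat.le_add_left _ _)
    -- The left side is ν_{i+1} when α_{i+1} ≤ β_{i+1}, and otherwise at most β_{i+1} + 1 ≤ α_{i+1}.
    have hb' : ∀ i, α.rowLen i ≤ β.rowLen i → β.rowLen (i + 1) + τ (i + 1) ≤ α.rowLen i := by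
      intro i hi
      have := hτ (i + 1); have := hτ1 (i + 1); have := hα i; have := hβ (i + 1)
      have := ha i; have := hα (i + 1)
      by_cases hq : α.rowLen (i + 1) ≤ β.rowLen (i + 1) <;> omega
    refine ⟨⟨⟨τ 0, fun _ => hτ1 0⟩, ofRowFun (fun i =>
      if α.rowLen i ≤ β.rowLen i then α.rowLen i - τ (i + 1) else α.rowLen i - 1)
      (antitone_nat_of_succ_le fun i => ?_) (α.colLen 0) ?_, ?_, ?_⟩, τ, rfl, hτ1, fun i => ?_⟩
    · have := hτ (i + 1); have := hτ1 (i + 1); have := hτ1 (i + 2)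
      have := hα i; have := hβ (i + 1); have := hα (i + 1); have := ha i; have := hb i
      have := hβ i; have := hb' i; have := hb' (i + 1)
      simp only [add_assoc, Nat.reduceAdd] at *
      split_ifs <;> omega
    · rw [rowLen_eq_zero (μ := α) le_rfl]
      simp
    · rw [strip_neg_one_iff]
      intro i
      rw [rowLen_ofRowFun]
      have := hτ1 (i + 1)
      split_ifs <;> omega
    · rw [strip_one_iff]
      intro i
      rw [rowLen_ofRowFun]
      have := hτ1 (i + 1); have := hb' i; have := hα i; have := hβ i; have := hβ (i + 1)
      have := hb i
      split_ifs <;> omega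
    · rw [rowLen_ofRowFun]
      have := hb' i; have := hτ i; have := hβ i
      refine ⟨fun h => ?_, fun h => (hτ i).2 h⟩
      rw [if_pos h]
      dsimp only
      omega
  · rintro ⟨⟨m, hm⟩, κ, hα, hβ⟩
    rw [strip_neg_one_iff] at hα
    rw [strip_one_iff] at hβ
    have hm := hm hne
    -- Read off from m and κ, the carry is determined from the top row downwards.
    let τ : ℕ → ℕ := fun i => Nat.rec m
      (fun i c => if α.rowLen i ≤ β.rowLen i then α.rowLen i - κ.rowLen i else c) i
    have hτ0 : τ 0 = m := rfl
    have hτs : ∀ i, τ (i + 1) = if α.rowLen i ≤ β.rowLen i then α.rowLen i - κ.rowLen i else τ i :=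
      fun i => rfl
    clear_value τ
    have hτ1 : ∀ i, τ i ≤ 1 := by
      intro i
      induction i with
      | zero => omega
      | succ i ih =>
        have := hα i
        rw [hτs]
        split_ifs <;> omega
    refine ⟨⟨ofRowFun (fun i => if α.rowLen i ≤ β.rowLen i then β.rowLen i + τ i else
        β.rowLen i + 1) (antitone_nat_of_succ_le fun i => ?_)
        (α.colLen 0 + β.colLen 0 + 1) ?_, ?_, ?_⟩, τ, hτ0, hτ1, fun i => ?_⟩
    · have := hτs i; have := hτ1 i; have := hτ1 (i + 1); have := hα i; have := hβ i
      have := ha i; have := hb i; have := hα (i + 1); have := hβ (i + 1)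
      split_ifs at * <;> omega
    · rw [rowLen_eq_zero (μ := α) (by omega), rowLen_eq_zero (μ := β) (by omega), hτs,
        rowLen_eq_zero (μ := α) (by omega), rowLen_eq_zero (μ := β) (by omega)]
      simp
    · rw [strip_one_iff]
      intro i
      rw [rowLen_ofRowFun, rowLen_ofRowFun]
      have := hτs i; have := hτ1 i; have := hτ1 (i + 1); have := hα i; have := hβ i
      have := ha i; have := hb i; have := hα (i + 1); have := hβ (i + 1)
      split_ifs at * <;> omega
    · rw [strip_neg_one_iff]
      intro i
      rw [rowLen_ofRowFun]
      have := hτ1 i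
      split_ifs <;> omega
    · rw [rowLen_ofRowFun]
      have := hτs i; have := hα i
      dsimp only
      split_ifs at * <;> omega
  · rintro ⟨ν, hν⟩ ⟨⟨m, hm⟩, κ, hκ⟩ ⟨⟨m', hm'⟩, κ', hκ'⟩ ⟨τ, h0, -, h1⟩ ⟨τ', h0', -, h1'⟩
    dsimp only at *
    have hττ : ∀ d i, α.colLen 0 ≤ i + d → τ i = τ' i := by
      intro d
      induction d with
      | zero =>
        intro i hi
        have := (h1 i).1 (hQ i hi)
        have := (h1' i).1 (hQ i hi)
        omega
      | succ d ih =>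
        intro i hi
        have := ih (i + 1) (by omega)
        have := h1 i
        have := h1' i
        omega
    have hττ : ∀ i, τ i = τ' i := fun i => hττ _ i (Nat.le_add_left _ _)
    obtain rfl : m = m' := by rw [← h0, ← h0', hττ]
    rw [strip_one_iff, strip_neg_one_iff] at hκ hκ'
    obtain rfl : κ = κ' := ext_rowLen fun i => by
      have := h1 i; have := h1' i; have := hττ (i + 1)
      have := hκ.1 i; have := hκ.2 i; have := hκ'.1 i; have := hκ'.2 i
      omega
    rfl
  · rintro ⟨ν, hν⟩ ⟨ν', hν'⟩ ⟨⟨m, hm⟩, κ, hκ⟩ ⟨τ, h0, -, h1⟩ ⟨τ', h0', -, h1'⟩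
    dsimp only at *
    have hττ : ∀ i, τ i = τ' i := by
      intro i
      induction i with
      | zero => omega
      | succ i ih =>
        have := h1 i
        have := h1' i
        omega
    rw [strip_one_iff, strip_neg_one_iff] at hν hν'
    obtain rfl : ν = ν' := ext_rowLen fun i => by
      have := h1 i; have := h1' i; have := hττ i
      have := hν.1 i; have := hν.2 i; have := hν'.1 i; have := hν'.2 i
      omega
    rfl

theorem HasGrowth.swap {t t' : ℤˣ} {α β : YoungDiagram} (h : HasGrowth t t' α β) :
    HasGrowth t' t β α := by
  obtain ⟨e, he⟩ := h
  refine ⟨((Equiv.subtypeEquivRight fun _ => and_comm).trans e).trans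
    (Equiv.prodCongr (Equiv.subtypeEquivRight fun m => by rw [ne_comm])
      (Equiv.subtypeEquivRight fun _ => and_comm)), fun ν => ?_⟩
  have := he (Equiv.subtypeEquivRight (fun _ => and_comm) ν)
  rw [add_comm β.card]
  exact this

/-- Transposing preserves sizes and negates both types, so it does not affect whether they agree. -/
theorem HasGrowth.of_transpose {t t' : ℤˣ} {α β : YoungDiagram}
    (h : HasGrowth (-t) (-t') α.transpose β.transpose) : HasGrowth t t' α β := by
  obtain ⟨e, he⟩ := h
  have htr : ∀ μ : YoungDiagram, transposeOrderIso μ = μ.transpose := fun _ => rfl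
  refine ⟨((transposeOrderIso.toEquiv.subtypeEquiv fun ν => ?_).trans e).trans
    (Equiv.prodCongr (Equiv.subtypeEquivRight fun m => by rw [ne_eq, neg_inj])
      (transposeOrderIso.toEquiv.subtypeEquiv fun κ => ?_).symm), fun ν => ?_⟩
  · simp only [RelIso.coe_fn_toEquiv, htr, strip_transpose]
  · simp only [RelIso.coe_fn_toEquiv, htr, strip_transpose]
  · have h := he (transposeOrderIso.toEquiv.subtypeEquiv (fun ν => by
      simp only [RelIso.coe_fn_toEquiv, htr, strip_transpose]) ν)
    rw [card_transpose, card_transpose] at h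
    exact (congrArg₂ (· + ·) (card_transpose _).symm (card_transpose _)).trans h

theorem hasGrowth (t t' : ℤˣ) (α β : YoungDiagram) : HasGrowth t t' α β := by
  rcases Int.units_eq_one_or t with rfl | rfl <;> rcases Int.units_eq_one_or t' with rfl | rfl
  · exact hasGrowth_one_one α β
  · exact hasGrowth_one_neg_one α β
  · exact (hasGrowth_one_neg_one β α).swap
  · apply HasGrowth.of_transpose
    rw [neg_neg]
    exact hasGrowth_one_one _ _

end YoungDiagram

open YoungDiagram

/-! ### Unconditional sums of power series with coefficients in [0, ∞] -/

namespace MvPowerSeries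

open scoped ENNReal

variable {σ ι κ : Type*}

/-- The coefficientwise sum of a family of power series with coefficients in `[0, ∞]`. -/
noncomputable def sumAll (f : ι → MvPowerSeries σ ℝ≥0∞) : MvPowerSeries σ ℝ≥0∞ :=
  fun c => ∑' i, coeff c (f i)

theorem coeff_sumAll (f : ι → MvPowerSeries σ ℝ≥0∞) (c : σ →₀ ℕ) :
    coeff c (sumAll f) = ∑' i, coeff c (f i) := rfl

theorem sumAll_comm (f : ι → κ → MvPowerSeries σ ℝ≥0∞) :
    sumAll (fun i => sumAll (f i)) = sumAll fun j => sumAll fun i => f i j := by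
  ext c
  exact ENNReal.tsum_comm

theorem mul_sumAll (a : MvPowerSeries σ ℝ≥0∞) (f : ι → MvPowerSeries σ ℝ≥0∞) :
    a * sumAll f = sumAll fun i => a * f i := by
  classical
  ext c
  simp only [coeff_sumAll, coeff_mul, ← ENNReal.tsum_mul_left]
  rw [Summable.tsum_finsetSum fun _ _ => ENNReal.summable]

theorem sumAll_mul (f : ι → MvPowerSeries σ ℝ≥0∞) (a : MvPowerSeries σ ℝ≥0∞) :
    sumAll f * a = sumAll fun i => f i * a := by
  rw [mul_comm, mul_sumAll]
  simp only [mul_comm]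

theorem sumAll_equiv (e : ι ≃ κ) (f : κ → MvPowerSeries σ ℝ≥0∞) :
    sumAll (fun i => f (e i)) = sumAll f := by
  ext c
  exact e.tsum_eq fun j => coeff c (f j)

theorem sumAll_prod (f : ι × κ → MvPowerSeries σ ℝ≥0∞) :
    sumAll f = sumAll fun i => sumAll fun j => f (i, j) := by
  ext c
  exact ENNReal.tsum_prod'

theorem sumAll_eq_single (i : ι) (f : ι → MvPowerSeries σ ℝ≥0∞) (h : ∀ j, j ≠ i → f j = 0) :
    sumAll f = f i := by
  ext c
  rw [coeff_sumAll]
  exact tsum_eq_single i fun j hj => by rw [h j hj, map_zero]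

theorem sumAll_subtype (p : ι → Prop) [DecidablePred p] (f : ι → MvPowerSeries σ ℝ≥0∞) :
    sumAll (fun i : {i // p i} => f i) = sumAll fun i => if p i then f i else 0 := by
  ext c
  rw [coeff_sumAll, coeff_sumAll]
  refine (tsum_subtype {i | p i} fun i => coeff c (f i)).trans (tsum_congr fun i => ?_)
  by_cases h : p i <;> simp [Set.indicator, h]

end MvPowerSeries

open MvPowerSeries
open scoped ENNReal Classical

variable {σ : Type}

/-! ### The exchange relation and the Cauchy identity -/

/-- The factor produced by exchanging an adding and a removing operator: `1 / (1 - w)` if their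
types agree and `1 + w` otherwise. -/
noncomputable def exchangeFactor (t t' : ℤˣ) (w : MvPowerSeries σ ℝ≥0∞) : MvPowerSeries σ ℝ≥0∞ :=
  sumAll fun m : {m : ℕ // t ≠ t' → m ≤ 1} => w ^ m.1

/-- The weight `x ^ |ν / κ|` if `ν / κ` is a strip of type `t`, and `0` otherwise. -/
noncomputable def stripWeight (t : ℤˣ) (x : MvPowerSeries σ ℝ≥0∞) (κ ν : YoungDiagram) :
    MvPowerSeries σ ℝ≥0∞ :=
  if Strip t κ ν then x ^ (ν.card - κ.card) else 0

/-- The growth bijection trades ν for (m, κ), and |ν| + |κ| = |α| + |β| + m makes the exponents of x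
and of y each grow by m. -/
theorem sumAll_stripWeight_mul (t t' : ℤˣ) (x y : MvPowerSeries σ ℝ≥0∞) (α β : YoungDiagram) :
    (sumAll fun ν => stripWeight t y α ν * stripWeight t' x β ν) =
      exchangeFactor t t' (x * y) *
        sumAll fun κ => stripWeight t' x κ α * stripWeight t y κ β := by
  obtain ⟨e, he⟩ := hasGrowth t t' α β
  have h1 : ∀ ν, stripWeight t y α ν * stripWeight t' x β ν =
      if Strip t α ν ∧ Strip t' β ν then y ^ (ν.card - α.card) * x ^ (ν.card - β.card) else 0 := by
    intro ν
    simp only [stripWeight, ite_and]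
    split_ifs <;> simp
  have h2 : ∀ κ, stripWeight t' x κ α * stripWeight t y κ β =
      if Strip t' κ α ∧ Strip t κ β then x ^ (α.card - κ.card) * y ^ (β.card - κ.card) else 0 := by
    intro ν
    simp only [stripWeight, ite_and]
    split_ifs <;> simp
  simp only [h1, h2]
  rw [← sumAll_subtype (fun ν => Strip t α ν ∧ Strip t' β ν),
    ← sumAll_subtype (fun κ => Strip t' κ α ∧ Strip t κ β), exchangeFactor, sumAll_mul]
  simp only [mul_sumAll]
  rw [← sumAll_prod (fun p : {m : ℕ // t ≠ t' → m ≤ 1} × {κ // Strip t' κ α ∧ Strip t κ β} =>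
    (x * y) ^ p.1.1 * (x ^ (α.card - p.2.1.card) * y ^ (β.card - p.2.1.card))), ← sumAll_equiv e]
  congr 1
  funext ν
  have := he ν
  have h3 := ν.2.1.card_le
  have h4 := ν.2.2.card_le
  have h5 := (e ν).2.2.1.card_le
  have h6 := (e ν).2.2.2.card_le
  rw [mul_pow, mul_mul_mul_comm, ← pow_add, ← pow_add, mul_comm]
  congr 2 <;> omega

/-- The weighted sum over all chains `ν = D 0 ⊇ D 1 ⊇ ⋯ ⊇ D n = ∅` whose steps are strips of the
types `t 0, t 1, …`, with weights `x 0, x 1, …`. -/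
noncomputable def chainSum (t : ℕ → ℤˣ) (x : ℕ → MvPowerSeries σ ℝ≥0∞) :
    ℕ → YoungDiagram → MvPowerSeries σ ℝ≥0∞
  | 0, ν => if ν = ⊥ then 1 else 0
  | n + 1, ν => sumAll fun κ => stripWeight (t 0) (x 0) κ ν *
      chainSum (fun i => t (i + 1)) (fun i => x (i + 1)) n κ

theorem strip_bot {t : ℤˣ} {κ : YoungDiagram} : Strip t κ ⊥ ↔ κ = ⊥ := by
  refine ⟨fun h => le_bot_iff.mp h.le, ?_⟩
  rintro rfl
  exact ⟨le_rfl, by split_ifs <;> simp⟩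

/-- A skew Cauchy identity: the strip of type `u` is moved past the steps of the chain one by one,
each exchange leaving its factor. At the end it meets ∅, where only the empty strip is left. -/
theorem sumAll_stripWeight_mul_chainSum (u : ℤˣ) (y : MvPowerSeries σ ℝ≥0∞) (t : ℕ → ℤˣ)
    (x : ℕ → MvPowerSeries σ ℝ≥0∞) (n : ℕ) (κ : YoungDiagram) :
    (sumAll fun ν => stripWeight u y κ ν * chainSum t x n ν) =
      (∏ i ∈ Finset.range n, exchangeFactor u (t i) (x i * y)) * chainSum t x n κ := by
  induction n generalizing t x κ with
  | zero =>
    rw [sumAll_eq_single ⊥ _ fun ν hν => by simp [chainSum, hν]]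
    simp only [chainSum, stripWeight, strip_bot, if_true, Finset.range_zero, Finset.prod_empty]
    split_ifs with h
    · simp [h]
    · simp
  | succ n ih =>
    have h : ∀ ν β : YoungDiagram, stripWeight u y κ ν * (stripWeight (t 0) (x 0) β ν *
        chainSum (fun i => t (i + 1)) (fun i => x (i + 1)) n β) =
        stripWeight u y κ ν * stripWeight (t 0) (x 0) β ν *
          chainSum (fun i => t (i + 1)) (fun i => x (i + 1)) n β := fun _ _ => (mul_assoc _ _ _).symm
    simp only [chainSum, mul_sumAll, h]
    rw [sumAll_comm]
    -- With the sum over ν innermost, the new strip is exchanged with the first step of the chain.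
    simp only [← sumAll_mul, sumAll_stripWeight_mul]
    simp only [mul_assoc]
    rw [← mul_sumAll]
    simp only [sumAll_mul]
    rw [sumAll_comm]
    simp only [mul_assoc, ← mul_sumAll, ih]
    rw [Finset.prod_range_succ']
    simp only [mul_sumAll]
    congr 1
    funext κ'
    ring

theorem sumAll_chainSum_mul (t u : ℕ → ℤˣ) (x y : ℕ → MvPowerSeries σ ℝ≥0∞) (n m : ℕ) :
    (sumAll fun ν => chainSum t x n ν * chainSum u y m ν) =
      ∏ j ∈ Finset.range m, ∏ i ∈ Finset.range n, exchangeFactor (u j) (t i) (x i * y j) := by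
  have hbot : ∀ (t : ℕ → ℤˣ) (x : ℕ → MvPowerSeries σ ℝ≥0∞), chainSum t x n ⊥ = 1 := by
    induction n with
    | zero => simp [chainSum]
    | succ n ih =>
      intro t x
      rw [chainSum, sumAll_eq_single ⊥ _ fun ν hν => by simp [stripWeight, strip_bot, hν], ih]
      simp [stripWeight, strip_bot]
  induction m generalizing u y with
  | zero =>
    rw [sumAll_eq_single ⊥ _ fun ν hν => by simp [chainSum, hν], hbot]
    simp [chainSum]
  | succ m ih =>
    have h : ∀ ν κ : YoungDiagram, chainSum t x n ν * (stripWeight (u 0) (y 0) κ ν *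
        chainSum (fun i => u (i + 1)) (fun i => y (i + 1)) m κ) =
        stripWeight (u 0) (y 0) κ ν * chainSum t x n ν *
          chainSum (fun i => u (i + 1)) (fun i => y (i + 1)) m κ := fun _ _ => by ring
    simp only [chainSum, mul_sumAll, h]
    rw [sumAll_comm]
    simp only [← sumAll_mul, sumAll_stripWeight_mul_chainSum]
    simp only [mul_assoc]
    rw [← mul_sumAll, ih, Finset.prod_range_succ', mul_comm]

/-! ### Chains of strips and their weights -/

/-- `D 0 ⊇ D 1 ⊇ ⋯ ⊇ D n = ∅` is a chain whose steps are strips of the types `t 0, t 1, …`. -/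
def IsStripChain (t : ℕ → ℤˣ) (n : ℕ) (D : ℕ → YoungDiagram) : Prop :=
  (∀ a < n, Strip (t a) (D (a + 1)) (D a)) ∧ ∀ a, n ≤ a → D a = ⊥

theorem IsStripChain.strip {t : ℕ → ℤˣ} {n : ℕ} {D : ℕ → YoungDiagram} (h : IsStripChain t n D)
    (a : ℕ) : Strip (t a) (D (a + 1)) (D a) := by
  by_cases ha : a < n
  · exact h.1 a ha
  · rw [h.2 a (not_lt.mp ha), h.2 (a + 1) (by omega), strip_bot]

theorem isStripChain_succ_iff {t : ℕ → ℤˣ} {n : ℕ} {D : ℕ → YoungDiagram} :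
    IsStripChain t (n + 1) D ↔
      Strip (t 0) (D 1) (D 0) ∧ IsStripChain (fun i => t (i + 1)) n fun i => D (i + 1) := by
  constructor
  · exact fun h => ⟨h.1 0 (Nat.succ_pos n), fun a ha => h.1 (a + 1) (by omega),
      fun a ha => h.2 (a + 1) (by omega)⟩
  · rintro ⟨h0, h1, h2⟩
    refine ⟨fun a ha => ?_, fun a ha => ?_⟩
    · rcases a with _ | a
      · exact h0
      · exact h1 a (by omega)
    · obtain ⟨a, rfl⟩ := Nat.exists_eq_add_of_le' ha
      exact h2 (a + n) (by omega)

/-- Splitting off the first term of a sequence. -/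
def seqConsEquiv (A : Type*) : A × (ℕ → A) ≃ (ℕ → A) where
  toFun p i := Nat.casesOn i p.1 p.2
  invFun D := (D 0, fun i => D (i + 1))
  left_inv _ := rfl
  right_inv D := by
    funext i
    cases i <;> rfl

/-- The weight `∏ a < n, x a ^ |D a / D (a + 1)|` of a chain. -/
noncomputable def chainWeight (x : ℕ → MvPowerSeries σ ℝ≥0∞) (n : ℕ) (D : ℕ → YoungDiagram) :
    MvPowerSeries σ ℝ≥0∞ :=
  ∏ a ∈ Finset.range n, x a ^ ((D a).card - (D (a + 1)).card)

theorem chainSum_eq (t : ℕ → ℤˣ) (x : ℕ → MvPowerSeries σ ℝ≥0∞) (n : ℕ) (ν : YoungDiagram) :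
    chainSum t x n ν =
      sumAll fun D => if IsStripChain t n D ∧ D 0 = ν then chainWeight x n D else 0 := by
  induction n generalizing t x ν with
  | zero =>
    rw [sumAll_eq_single (fun _ => ⊥)]
    · simp [chainSum, chainWeight, IsStripChain, eq_comm]
    · intro D hD
      refine if_neg fun h => hD ?_
      funext a
      exact h.1.2 a (Nat.zero_le a)
  | succ n ih =>
    rw [← sumAll_equiv (seqConsEquiv YoungDiagram), sumAll_prod, sumAll_eq_single ν]
    · simp only [chainSum, ih, mul_sumAll]
      rw [sumAll_comm]
      congr 1
      funext D
      rw [sumAll_eq_single (D 0) _ fun κ hκ => by rw [if_neg fun h => hκ h.2.symm, mul_zero]]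
      have h1 : IsStripChain t (n + 1) (seqConsEquiv _ (ν, D)) ↔
          Strip (t 0) (D 0) ν ∧ IsStripChain (fun i => t (i + 1)) n D := isStripChain_succ_iff
      have h2 : seqConsEquiv _ (ν, D) 0 = ν := rfl
      have h3 : chainWeight x (n + 1) (seqConsEquiv _ (ν, D)) =
          chainWeight (fun i => x (i + 1)) n D * x 0 ^ (ν.card - (D 0).card) :=
        Finset.prod_range_succ' _ _
      simp only [h1, h2, h3, stripWeight, and_true]
      by_cases ha : Strip (t 0) (D 0) ν <;>
        by_cases hb : IsStripChain (fun i => t (i + 1)) n D <;> simp [ha, hb, mul_comm]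
    · intro κ hκ
      ext c
      rw [coeff_sumAll, map_zero, ENNReal.tsum_eq_zero]
      intro D
      rw [if_neg fun h => hκ h.2, map_zero]

/-- Abel summation. It converts strip sizes weighted by accumulated exponents into diagram sizes
weighted by single exponents. -/
theorem sum_tsub_smul_add {A : Type*} [AddCommMonoid A] (d : ℕ → ℕ) (hd : ∀ a, d (a + 1) ≤ d a)
    (e : ℕ → A) (n : ℕ) :
    (∑ a ∈ Finset.range n, (d a - d (a + 1)) • ∑ b ∈ Finset.range (a + 1), e b) +
      d n • ∑ b ∈ Finset.range n, e b = ∑ a ∈ Finset.range n, d a • e a := by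
  induction n with
  | zero => simp
  | succ n ih =>
    rw [Finset.sum_range_succ _ n, add_assoc, ← add_smul, Nat.sub_add_cancel (hd n),
      Finset.sum_range_succ _ n, smul_add, ← add_assoc, ih, Finset.sum_range_succ _ n]

theorem chainWeight_monomial {t : ℕ → ℤˣ} {n : ℕ} {D : ℕ → YoungDiagram} (h : IsStripChain t n D)
    (e : ℕ → σ →₀ ℕ) :
    chainWeight (fun a => monomial (∑ b ∈ Finset.range (a + 1), e b) (1 : ℝ≥0∞)) n D =
      monomial (∑ a ∈ Finset.range n, (D a).card • e a) 1 := by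
  have h1 := sum_tsub_smul_add (fun a => (D a).card) (fun a => (h.strip a).card_le) e n
  rw [h.2 n le_rfl] at h1
  simp only [YoungDiagram.card, cells_bot, Finset.card_empty, zero_smul, add_zero] at h1
  simp only [YoungDiagram.card, ← h1, chainWeight, monomial_pow, one_pow, prod_monomial,
    Finset.prod_const_one]

/-- Pairs of chains of strips which start at the same diagram. -/
def IsStripChainPair (t : ℕ → ℤˣ) (n : ℕ) (u : ℕ → ℤˣ) (m : ℕ)
    (p : (ℕ → YoungDiagram) × (ℕ → YoungDiagram)) : Prop :=
  IsStripChain t n p.1 ∧ IsStripChain u m p.2 ∧ p.1 0 = p.2 0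

theorem sumAll_monomial_chainPair (t : ℕ → ℤˣ) (n : ℕ) (u : ℕ → ℤˣ) (m : ℕ) (e f : ℕ → σ →₀ ℕ) :
    (sumAll fun p : {p // IsStripChainPair t n u m p} =>
        monomial ((∑ a ∈ Finset.range n, (p.1.1 a).card • e a) +
          ∑ b ∈ Finset.range m, (p.1.2 b).card • f b) (1 : ℝ≥0∞)) =
      ∏ j ∈ Finset.range m, ∏ i ∈ Finset.range n, exchangeFactor (u j) (t i)
        (monomial ((∑ b ∈ Finset.range (i + 1), e b) + ∑ b ∈ Finset.range (j + 1), f b) 1) := by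
  have h := sumAll_chainSum_mul t u
    (fun a => monomial (∑ b ∈ Finset.range (a + 1), e b) (1 : ℝ≥0∞))
    (fun a => monomial (∑ b ∈ Finset.range (a + 1), f b) (1 : ℝ≥0∞)) n m
  simp only [monomial_mul_monomial, mul_one] at h
  rw [← h, sumAll_subtype (IsStripChainPair t n u m) fun p =>
    monomial ((∑ a ∈ Finset.range n, (p.1 a).card • e a) +
          ∑ b ∈ Finset.range m, (p.2 b).card • f b) (1 : ℝ≥0∞)]
  simp only [chainSum_eq, sumAll_mul]
  simp only [mul_sumAll]
  rw [sumAll_comm, sumAll_prod]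
  congr 1
  funext D
  rw [sumAll_comm]
  congr 1
  funext E
  rw [sumAll_eq_single (D 0) _ fun ν hν => by rw [if_neg fun h => hν h.2.symm, zero_mul]]
  by_cases h1 : IsStripChain t n D
  · by_cases h2 : IsStripChain u m E
    · simp only [IsStripChainPair, h1, h2, true_and, and_true, if_true, mul_ite, mul_zero,
        chainWeight_monomial h1, chainWeight_monomial h2, monomial_mul_monomial, mul_one,
        eq_comm (a := D 0)]
    · simp [IsStripChainPair, h2]
  · simp [IsStripChainPair, h1]

/-! ### Partitions as sequences padded by zeros -/

theorem isSignedPartition_iff {t : ℕ → ℤˣ} {ε : ℤˣ} {l : List ℕ} :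
    IsSignedPartition t ε l ↔ (∀ a ∈ l, 0 < a) ∧ ∀ i, l.getD (i + 1) 0 ≤ l.getD i 0 ∧
      (0 < l.getD i 0 → l.getD (i + 1) 0 = l.getD i 0 → t (l.getD i 0) = ε) := by
  unfold IsSignedPartition
  rw [List.isChain_iff_getElem]
  refine and_congr_right fun hpos => ⟨fun h i => ?_, fun h i hi => ?_⟩
  · by_cases hi : i + 1 < l.length
    · have := h i hi
      rw [List.getD_eq_getElem _ _ hi, List.getD_eq_getElem _ _ (Nat.lt_of_succ_lt hi)]
      refine ⟨?_, fun _ h1 => ?_⟩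
      · omega
      · rcases this with h2 | h2
        · omega
        · exact h2.2
    · rw [List.getD_eq_default _ _ (not_lt.mp hi)]
      exact ⟨Nat.zero_le _, fun h1 h2 => absurd h2 h1.ne⟩
  · have := h i
    rw [List.getD_eq_getElem _ _ hi, List.getD_eq_getElem _ _ (Nat.lt_of_succ_lt hi)] at this
    rcases this.1.lt_or_eq with h1 | h1
    · exact Or.inl h1
    · exact Or.inr ⟨h1, this.2 (hpos _ (List.getElem_mem _)) h1⟩

theorem lt_length_iff_getD_pos {l : List ℕ} (hl : ∀ a ∈ l, 0 < a) {i : ℕ} :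
    i < l.length ↔ 0 < l.getD i 0 := by
  constructor
  · intro h
    rw [List.getD_eq_getElem _ _ h]
    exact hl _ (List.getElem_mem _)
  · intro h
    by_contra hi
    rw [List.getD_eq_default _ _ (not_lt.mp hi)] at h
    exact lt_irrefl _ h

theorem length_le_length_iff {l l' : List ℕ} (hl : ∀ a ∈ l, 0 < a) (hl' : ∀ a ∈ l', 0 < a) :
    l.length ≤ l'.length ↔ ∀ i, 0 < l.getD i 0 → 0 < l'.getD i 0 := by
  simp only [← lt_length_iff_getD_pos hl, ← lt_length_iff_getD_pos hl']
  exact ⟨fun h i hi => hi.trans_le h, fun h => forall_lt_iff_le.mp h⟩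

theorem eq_of_getD_eq {l l' : List ℕ} (hl : ∀ a ∈ l, 0 < a) (hl' : ∀ a ∈ l', 0 < a)
    (h : ∀ i, l.getD i 0 = l'.getD i 0) : l = l' := by
  have hlen : l.length = l'.length := le_antisymm
    ((length_le_length_iff hl hl').mpr fun i hi => by rwa [← h])
    ((length_le_length_iff hl' hl).mpr fun i hi => by rwa [h])
  refine List.ext_getElem hlen fun i h1 h2 => ?_
  have := h i
  rwa [List.getD_eq_getElem _ _ h1, List.getD_eq_getElem _ _ h2] at this

theorem exists_list_getD_eq (f : ℕ → ℕ) (hf : ∀ i, f (i + 1) ≤ f i) {n : ℕ} (hn : f n = 0) :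
    ∃ l : List ℕ, (∀ a ∈ l, 0 < a) ∧ ∀ i, l.getD i 0 = f i := by
  induction n generalizing f with
  | zero =>
    have hf' := antitone_nat_of_succ_le hf
    exact ⟨[], by simp, fun i => by have := hf' (Nat.zero_le i); simp; omega⟩
  | succ n ih =>
    obtain ⟨l, h1, h2⟩ := ih (fun i => f (i + 1)) (fun i => hf (i + 1)) hn
    by_cases h0 : f 0 = 0
    · have hf' := antitone_nat_of_succ_le hf
      exact ⟨[], by simp, fun i => by have := hf' (Nat.zero_le i); simp; omega⟩
    · refine ⟨f 0 :: l, ?_, fun i => ?_⟩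
      · simp only [List.mem_cons, forall_eq_or_imp]
        exact ⟨Nat.pos_of_ne_zero h0, h1⟩
      · rcases i with _ | i
        · rfl
        · exact h2 i

/-! ### Signed arrays and their level sets -/

/-- The array `v` decreases weakly in both directions, where a positive value `a` may be repeated
in the second direction only if `g a = 1`, and in the first direction only if `g a = -1`. -/
def IsSignedArray (g : ℕ → ℤˣ) (v : ℕ → ℕ → ℕ) : Prop :=
  ∀ r i, (v r (i + 1) ≤ v r i ∧ (0 < v r i → v r (i + 1) = v r i → g (v r i) = 1)) ∧
    (v (r + 1) i ≤ v r i ∧ (0 < v r i → v (r + 1) i = v r i → g (v r i) = -1))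

/-- The cells of D_a / D_{a+1} are those with value a + 1. By monotonicity, two of them in one row
or column force two neighbouring ones, which is the repetition the sign forbids. -/
theorem isSignedArray_iff_strip {g : ℕ → ℤˣ} {v : ℕ → ℕ → ℕ} {D : ℕ → YoungDiagram}
    (h : ∀ a r i, (r, i) ∈ D a ↔ a < v r i) :
    IsSignedArray g v ↔ ∀ a, Strip (g (a + 1)) (D (a + 1)) (D a) := by
  have hne : (-1 : ℤˣ) ≠ 1 := by decide
  constructor
  · intro hv a
    refine ⟨?_, ?_⟩
    · rintro ⟨r, i⟩ hc
      have hc' : (r, i) ∈ D (a + 1) := hc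
      rw [h] at hc'
      exact (h a r i).mpr (by omega)
    · split_ifs with hg
      · intro r i
        rw [h, h]
        intro hlt
        have := (hv r i).2
        by_contra hle
        have h1 : v r i = a + 1 := by omega
        have h2 : v (r + 1) i = a + 1 := by omega
        have h3 := this.2 (by omega) (by omega)
        rw [h1, hg] at h3
        exact hne h3.symm
      · intro r i
        rw [h, h]
        intro hlt
        have := (hv r i).1
        by_contra hle
        have h1 : v r i = a + 1 := by omega
        have h2 : v r (i + 1) = a + 1 := by omega
        have h3 := this.2 (by omega) (by omega)
        rw [h1] at h3
        exact hg h3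
  · intro hD r i
    refine ⟨⟨?_, fun h0 h1 => ?_⟩, ⟨?_, fun h0 h1 => ?_⟩⟩
    · refine forall_lt_iff_le.mp fun a ha => ?_
      rw [← h] at ha ⊢
      exact (D a).up_left_mem le_rfl (Nat.le_succ i) ha
    · obtain ⟨a, ha⟩ := Nat.exists_eq_add_of_lt h0
      rw [zero_add] at ha
      rw [ha]
      by_contra hg
      have := (hD a).2
      rw [if_neg hg] at this
      have := this r i
      rw [h, h] at this
      omega
    · refine forall_lt_iff_le.mp fun a ha => ?_
      rw [← h] at ha ⊢
      exact (D a).up_left_mem (Nat.le_succ r) le_rfl ha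
    · obtain ⟨a, ha⟩ := Nat.exists_eq_add_of_lt h0
      rw [zero_add] at ha
      rw [ha]
      refine (Int.units_eq_one_or _).resolve_left fun hg => ?_
      have := (hD a).2
      rw [if_pos hg] at this
      have := this r i
      rw [h, h] at this
      omega

theorem IsSignedArray.le {g : ℕ → ℤˣ} {v : ℕ → ℕ → ℕ} (hv : IsSignedArray g v) {r r' i i' : ℕ}
    (hr : r ≤ r') (hi : i ≤ i') : v r' i' ≤ v r i :=
  (antitone_nat_of_succ_le (f := fun r => v r i') (fun r => (hv r i').2.1) hr).trans
    (antitone_nat_of_succ_le (f := v r) (fun i => (hv r i).1.1) hi)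

theorem IsSignedArray.exists_diagrams {g : ℕ → ℤˣ} {v : ℕ → ℕ → ℕ} (hv : IsSignedArray g v)
    {R M : ℕ} (hR : ∀ i, v R i = 0) (hM : v 0 M = 0) :
    ∃ D : ℕ → YoungDiagram, ∀ a r i, (r, i) ∈ D a ↔ a < v r i := by
  refine ⟨fun a => ⟨(Finset.range R ×ˢ Finset.range M).filter fun c => a < v c.1 c.2, ?_⟩,
    fun a r i => ?_⟩
  · intro b c hbc hb
    have h3 := hv.le hbc.1 hbc.2
    have h1 : c.1 ≤ b.1 := hbc.1
    have h2 : c.2 ≤ b.2 := hbc.2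
    simp only [Finset.coe_filter, Finset.mem_product, Finset.mem_range, Set.mem_ofPred_eq] at hb ⊢
    omega
  · rw [← mem_cells]
    simp only [Finset.mem_filter, Finset.mem_product, Finset.mem_range, and_iff_right_iff_imp]
    intro ha
    constructor
    · by_contra hr
      have := hv.le (not_lt.mp hr) (le_refl i)
      have := hR i
      omega
    · by_contra hi
      have := hv.le (Nat.zero_le r) (not_lt.mp hi)
      omega

theorem exists_array {D : ℕ → YoungDiagram} (hD : ∀ a, D (a + 1) ≤ D a) {L : ℕ} (hL : D L = ⊥) :
    ∃ v : ℕ → ℕ → ℕ, ∀ a r i, (r, i) ∈ D a ↔ a < v r i := by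
  have h : ∀ r i, ∃ a, (r, i) ∉ D a := fun r i => ⟨L, by simp [hL]⟩
  -- The value at a cell is the first index whose diagram omits it.
  refine ⟨fun r i => Nat.find (h r i), fun a r i => ?_⟩
  rw [Nat.lt_find_iff]
  simp only [not_not]
  exact ⟨fun ha b hb => antitone_nat_of_succ_le hD hb ha, fun ha => ha a le_rfl⟩

theorem sum_sum_sum_range_eq {A : Type*} [AddCommMonoid A] {D : ℕ → YoungDiagram}
    {v : ℕ → ℕ → ℕ} (h : ∀ a r i, (r, i) ∈ D a ↔ a < v r i) {R M L : ℕ}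
    (hRM : ∀ r i, 0 < v r i → r < R ∧ i < M) (hL : ∀ r i, v r i ≤ L) (e : ℕ → A) :
    ∑ r ∈ Finset.range R, ∑ i ∈ Finset.range M, ∑ a ∈ Finset.range (v r i), e a =
      ∑ a ∈ Finset.range L, (D a).card • e a := by
  have h1 : ∀ r i, ∑ a ∈ Finset.range (v r i), e a =
      ∑ a ∈ Finset.range L, if (r, i) ∈ D a then e a else 0 := by
    intro r i
    rw [← Finset.sum_filter]
    refine Finset.sum_congr ?_ fun _ _ => rfl
    ext a
    have := hL r i
    simp only [Finset.mem_range, Finset.mem_filter, h]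
    omega
  simp only [h1]
  rw [← Finset.sum_product', Finset.sum_comm]
  refine Finset.sum_congr rfl fun a _ => ?_
  rw [← Finset.sum_filter, Finset.sum_const]
  congr 1
  congr 1
  ext ⟨r, i⟩
  rw [mem_cells]
  simp only [Finset.mem_filter, Finset.mem_product, Finset.mem_range, and_iff_right_iff_imp, h]
  exact fun ha => hRM r i (by omega)

theorem list_sum_map_eq {A : Type*} [AddCommMonoid A] (l : List ℕ) (F : ℕ → A) (hF : F 0 = 0)
    {M : ℕ} (hM : l.length ≤ M) : (l.map F).sum = ∑ i ∈ Finset.range M, F (l.getD i 0) := by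
  induction l generalizing M with
  | nil => simp [hF]
  | cons a l ih =>
    obtain ⟨M, rfl⟩ := Nat.exists_eq_add_of_le' (show 1 ≤ M from le_trans (by simp) hM)
    rw [Finset.sum_range_succ', List.map_cons, List.sum_cons, add_comm,
      ih (M := M) (by simpa using hM)]
    simp

theorem Int.units_mul_eq_one_iff {x y : ℤˣ} : x * y = 1 ↔ x = y := by
  revert x y; decide

theorem Int.units_mul_eq_neg_one_iff {x y : ℤˣ} : x * y = -1 ↔ x = -y := by
  revert x y; decide

theorem pairGE_iff {s : ℤ → ℤˣ} {k : ℤ} {l₁ m₁ l₂ m₂ : List ℕ} (hl₁ : ∀ a ∈ l₁, 0 < a)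
    (hm₁ : ∀ a ∈ m₁, 0 < a) (hl₂ : ∀ a ∈ l₂, 0 < a) (hm₂ : ∀ a ∈ m₂, 0 < a) :
    PairGE s k l₁ m₁ l₂ m₂ ↔ (∀ i, 0 < l₂.getD i 0 → 0 < m₁.getD i 0) ∧
      (∀ i, l₂.getD i 0 ≤ l₁.getD i 0 ∧ (0 < l₁.getD i 0 → l₂.getD i 0 = l₁.getD i 0 →
        s (k + (l₁.getD i 0 : ℤ)) * s k = -1)) ∧
      (∀ i, m₂.getD i 0 ≤ m₁.getD i 0 ∧ (0 < m₁.getD i 0 → m₂.getD i 0 = m₁.getD i 0 →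
        s (k - (m₁.getD i 0 : ℤ)) * s k = -1)) := by
  unfold PairGE
  rw [length_le_length_iff hl₂ hm₁, length_le_length_iff hl₂ hl₁, length_le_length_iff hm₂ hm₁]
  simp only [lt_length_iff_getD_pos hl₂, lt_length_iff_getD_pos hm₂, Int.units_mul_eq_neg_one_iff,
    add_comm _ k, ← sub_eq_add_neg]
  refine and_congr_right fun h0 => ⟨fun h => ⟨fun i => ?_, fun i => ?_⟩,
    fun h => ⟨fun i hi => ?_, fun i hi => ?_, fun i hi => ?_, fun i hi => ?_⟩⟩
  · have := h.2.2.1 i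
    refine ⟨by omega, fun h1 h2 => ?_⟩
    rcases this (by omega) with h3 | h3
    · omega
    · exact h3.2.resolve_right h1.ne'
  · have := h.2.2.2 i
    refine ⟨by omega, fun h1 h2 => ?_⟩
    rcases this (by omega) with h3 | h3
    · omega
    · exact h3.2.resolve_right h1.ne'
  · exact hi.trans_le (h.1 i).1
  · exact hi.trans_le (h.2 i).1
  · rcases (h.1 i).1.lt_or_eq with h1 | h1
    · exact Or.inl h1
    · exact Or.inr ⟨h1, Or.inl ((h.1 i).2 (by omega) h1)⟩
  · rcases (h.2 i).1.lt_or_eq with h1 | h1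
    · exact Or.inl h1
    · exact Or.inr ⟨h1, Or.inl ((h.2 i).2 (by omega) h1)⟩

/-! ### Plane s-partitions as pairs of strip chains -/

namespace PlaneSPartition

variable {s : ℤ → ℤˣ} {k : ℤ}

theorem pairGE_layer (P : PlaneSPartition s k) (r : ℕ) :
    (∀ i, 0 < (P.lam (r + 1)).getD i 0 → 0 < (P.mu r).getD i 0) ∧
      (∀ i, (P.lam (r + 1)).getD i 0 ≤ (P.lam r).getD i 0 ∧ (0 < (P.lam r).getD i 0 →
        (P.lam (r + 1)).getD i 0 = (P.lam r).getD i 0 →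
          s (k + ((P.lam r).getD i 0 : ℤ)) * s k = -1)) ∧
      (∀ i, (P.mu (r + 1)).getD i 0 ≤ (P.mu r).getD i 0 ∧ (0 < (P.mu r).getD i 0 →
        (P.mu (r + 1)).getD i 0 = (P.mu r).getD i 0 →
          s (k - ((P.mu r).getD i 0 : ℤ)) * s k = -1)) :=
  (pairGE_iff (P.lam_partition r).1 (P.mu_partition r).1 (P.lam_partition (r + 1)).1
    (P.mu_partition (r + 1)).1).mp (P.layers_ge r)

theorem isSignedArray_lam (P : PlaneSPartition s k) :
    IsSignedArray (fun a => s (k + (a : ℤ)) * s k) fun r i => (P.lam r).getD i 0 := by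
  intro r i
  have h := (isSignedPartition_iff.mp (P.lam_partition r)).2 i
  refine ⟨?_, (P.pairGE_layer r).2.1 i⟩
  simp only [Int.units_mul_eq_one_iff]
  exact h

theorem isSignedArray_mu (P : PlaneSPartition s k) :
    IsSignedArray (fun a => s (k - (a : ℤ)) * s k) fun r i => (P.mu r).getD i 0 := by
  intro r i
  have h := (isSignedPartition_iff.mp (P.mu_partition r)).2 i
  refine ⟨?_, (P.pairGE_layer r).2.2 i⟩
  simp only [Int.units_mul_eq_one_iff]
  exact h

theorem lam_pos_of_mu_pos (P : PlaneSPartition s k) {r i : ℕ} (h : 0 < (P.mu r).getD i 0) :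
    0 < (P.lam r).getD i 0 :=
  (length_le_length_iff (P.mu_partition r).1 (P.lam_partition r).1).mp (P.length_mu_le r) i h

theorem mu_pos_of_lam_pos (P : PlaneSPartition s k) {r i : ℕ} (h : 0 < (P.lam (r + 1)).getD i 0) :
    0 < (P.mu r).getD i 0 :=
  (P.pairGE_layer r).1 i h

theorem exists_lam_eq_nil (P : PlaneSPartition s k) : ∃ R, P.lam R = [] := by
  obtain ⟨R, hR⟩ := P.finite_layers.exists_notMem
  simp only [Set.mem_ofPred_eq, not_not] at hR
  exact ⟨R, hR.1⟩

theorem isRestricted_iff {P : PlaneSPartition s k} {L₁ L₂ : ℕ} :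
    P.IsRestricted L₁ L₂ ↔ (P.lam 0).getD 0 0 ≤ L₁ ∧ (P.mu 0).getD 0 0 ≤ L₂ := by
  have : ∀ l : List ℕ, l.headD 0 = l.getD 0 0 := fun l => by cases l <;> rfl
  rw [IsRestricted, this, this]

theorem ext_getD {P Q : PlaneSPartition s k}
    (hl : ∀ r i, (P.lam r).getD i 0 = (Q.lam r).getD i 0)
    (hm : ∀ r i, (P.mu r).getD i 0 = (Q.mu r).getD i 0) : P = Q := by
  have h1 : P.lam = Q.lam := funext fun r =>
    eq_of_getD_eq (P.lam_partition r).1 (Q.lam_partition r).1 (hl r)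
  have h2 : P.mu = Q.mu := funext fun r =>
    eq_of_getD_eq (P.mu_partition r).1 (Q.mu_partition r).1 (hm r)
  cases P
  cases Q
  simp only at h1 h2
  subst h1 h2
  rfl

theorem exists_of_arrays {v w : ℕ → ℕ → ℕ}
    (hv : IsSignedArray (fun a => s (k + (a : ℤ)) * s k) v)
    (hw : IsSignedArray (fun a => s (k - (a : ℤ)) * s k) w)
    (hwv : ∀ r i, 0 < w r i → 0 < v r i) (hvw : ∀ r i, 0 < v (r + 1) i → 0 < w r i)
    {R M : ℕ} (hR : ∀ i, v R i = 0) (hM : v 0 M = 0) :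
    ∃ P : PlaneSPartition s k, (∀ r i, (P.lam r).getD i 0 = v r i) ∧
      ∀ r i, (P.mu r).getD i 0 = w r i := by
  have hvM : ∀ r, v r M = 0 := fun r => by
    have := hv.le (Nat.zero_le r) (le_refl M)
    omega
  choose l hl hlv using fun r => exists_list_getD_eq (v r) (fun i => (hv r i).1.1) (hvM r)
  choose m hm hmw using fun r => exists_list_getD_eq (w r) (fun i => (hw r i).1.1) (n := M)
    (by have := hwv r M; have := hvM r; omega)
  refine ⟨⟨l, m, fun r => ?_, fun r => ?_, fun r => ?_, fun r => ?_, ?_⟩, hlv, hmw⟩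
  · rw [isSignedPartition_iff]
    refine ⟨hl r, fun i => ?_⟩
    have := (hv r i).1
    simp only [Int.units_mul_eq_one_iff] at this
    simpa only [hlv] using this
  · rw [isSignedPartition_iff]
    refine ⟨hm r, fun i => ?_⟩
    have := (hw r i).1
    simp only [Int.units_mul_eq_one_iff] at this
    simpa only [hmw] using this
  · rw [length_le_length_iff (hm r) (hl r)]
    simpa only [hlv, hmw] using hwv r
  · rw [pairGE_iff (hl r) (hm r) (hl (r + 1)) (hm (r + 1))]
    simp only [hlv, hmw]
    exact ⟨hvw r, fun i => (hv r i).2, fun i => (hw r i).2⟩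
  · refine (Set.finite_Iio R).subset fun r hr => ?_
    simp only [Set.mem_ofPred_eq, Set.mem_Iio] at hr ⊢
    by_contra hle
    have hv0 : ∀ i, v r i = 0 := fun i => by
      have := hv.le (not_lt.mp hle) (le_refl i)
      have := hR i
      omega
    refine hr ⟨eq_of_getD_eq (hl r) (by simp) fun i => ?_,
      eq_of_getD_eq (hm r) (by simp) fun i => ?_⟩
    · rw [hlv, hv0, List.getD_nil]
    · have := hwv r i
      have := hv0 i
      rw [hmw, List.getD_nil]
      omega

/-- `p.2 a` (resp. `p.1 (b + 1)`) consists of the positions of the parts of the `lam r` which are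
greater than `a` (resp. of the parts of the `mu r` which are greater than `b`). -/
def HasDiagrams (P : PlaneSPartition s k) (p : (ℕ → YoungDiagram) × (ℕ → YoungDiagram)) : Prop :=
  (∀ a r i, (r, i) ∈ p.2 a ↔ a < (P.lam r).getD i 0) ∧
    ∀ b r i, (r, i) ∈ p.1 (b + 1) ↔ b < (P.mu r).getD i 0

/-- Step b ≥ 1 of the first chain removes the cells with μ-value b, and step a of the second those
with λ-value a + 1. The extra step b = 0 links the two arrays: it has type s_k s_k = 1, and the
strip condition there is ℓ(μ^(r)) ≤ ℓ(λ^(r)) together with ℓ(λ^(r+1)) ≤ ℓ(μ^(r)). -/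
theorem exists_equiv_chainPair (s : ℤ → ℤˣ) (k : ℤ) (L₁ L₂ : ℕ) :
    ∃ e : {P : PlaneSPartition s k // P.IsRestricted L₁ L₂} ≃
        {p // IsStripChainPair (fun b => s (k - (b : ℤ)) * s k) (L₂ + 1)
          (fun a => s (k + ((a + 1 : ℕ) : ℤ)) * s k) L₁ p},
      ∀ P, HasDiagrams P.1 (e P).1 := by
  apply exists_equiv_of_rel (fun (P : {P : PlaneSPartition s k // P.IsRestricted L₁ L₂})
    (p : {p // IsStripChainPair (fun b => s (k - (b : ℤ)) * s k) (L₂ + 1)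
          (fun a => s (k + ((a + 1 : ℕ) : ℤ)) * s k) L₁ p}) => HasDiagrams P.1 p.1)
  · rintro ⟨P, hP⟩
    rw [isRestricted_iff] at hP
    have hv := P.isSignedArray_lam
    have hw := P.isSignedArray_mu
    obtain ⟨R, hR⟩ := P.exists_lam_eq_nil
    obtain ⟨D, hD⟩ := hv.exists_diagrams (R := R) (M := (P.lam 0).length) (by simp [hR]) (by simp)
    obtain ⟨E, hE⟩ := hw.exists_diagrams (R := R) (M := (P.lam 0).length)
      (fun i => by
        have := P.lam_pos_of_mu_pos (r := R) (i := i)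
        simp only [hR, List.getD_nil] at this
        omega)
      (by
        have := P.lam_pos_of_mu_pos (r := 0) (i := (P.lam 0).length)
        rw [List.getD_eq_default (P.lam 0) _ le_rfl] at this
        omega)
    refine ⟨⟨(fun b => Nat.casesOn b (D 0) E, D), ?_, ?_, rfl⟩, hD, hE⟩
    · rw [isStripChain_succ_iff]
      refine ⟨?_, fun a _ => (isSignedArray_iff_strip hE).mp hw a, fun a ha => ?_⟩
      · have h1 : s (k - ((0 : ℕ) : ℤ)) * s k = 1 := by
          rw [Nat.cast_zero, sub_zero, Int.units_mul_eq_one_iff]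
        dsimp only
        rw [h1]
        refine ⟨?_, ?_⟩
        · rintro ⟨r, i⟩ hc
          exact (hD 0 r i).mpr (P.lam_pos_of_mu_pos ((hE 0 r i).mp hc))
        · rw [if_pos rfl]
          intro r i hc
          -- This is the condition ℓ(λ^(r+1)) ≤ ℓ(μ^(r)).
          exact (hE 0 r i).mpr (P.mu_pos_of_lam_pos ((hD 0 (r + 1) i).mp hc))
      · refine le_bot_iff.mp ?_
        rintro ⟨r, i⟩ hc
        have h1 := (hE a r i).mp hc
        have h2 := hw.le (Nat.zero_le r) (Nat.zero_le i)
        omega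
    · refine ⟨fun a _ => (isSignedArray_iff_strip hD).mp hv a, fun a ha => ?_⟩
      refine le_bot_iff.mp ?_
      rintro ⟨r, i⟩ hc
      have h1 := (hD a r i).mp hc
      have h2 := hv.le (Nat.zero_le r) (Nat.zero_le i)
      omega
  · rintro ⟨⟨E, D⟩, hE, hD, hED⟩
    dsimp only at hE hD hED
    have hE' := (isStripChain_succ_iff.mp hE).2
    have h0 := (isStripChain_succ_iff.mp hE).1
    obtain ⟨v, hv⟩ := exists_array (fun a => (hD.strip a).le) (hD.2 L₁ le_rfl)
    obtain ⟨w, hw⟩ := exists_array (D := fun b => E (b + 1)) (fun a => (hE'.strip a).le) (hE'.2 L₂ le_rfl)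
    have h1 : s (k - ((0 : ℕ) : ℤ)) * s k = 1 := by
      rw [Nat.cast_zero, sub_zero, Int.units_mul_eq_one_iff]
    rw [h1, hED] at h0
    have h2 := h0.2
    rw [if_pos rfl] at h2
    obtain ⟨P, hPv, hPw⟩ := exists_of_arrays (s := s) (k := k) (v := v) (w := w)
      ((isSignedArray_iff_strip hv).mpr hD.strip) ((isSignedArray_iff_strip hw).mpr hE'.strip)
      (fun r i h => (hv 0 r i).mp (h0.le ((hw 0 r i).mpr h)))
      (fun r i h => (hw 0 r i).mp (h2 r i ((hv 0 (r + 1) i).mpr h)))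
      (R := (D 0).colLen 0) (M := (D 0).rowLen 0)
      (fun i => by
        by_contra h
        have h3 := (hv 0 _ i).mpr (Nat.pos_of_ne_zero h)
        exact lt_irrefl _ (mem_iff_lt_colLen.mp ((D 0).up_left_mem le_rfl (Nat.zero_le i) h3)))
      (by
        by_contra h
        have h3 := (hv 0 _ _).mpr (Nat.pos_of_ne_zero h)
        exact lt_irrefl _ (mem_iff_lt_rowLen.mp h3))
    refine ⟨⟨P, isRestricted_iff.mpr ⟨?_, ?_⟩⟩, fun a r i => by rw [hPv]; exact hv a r i,
      fun a r i => by rw [hPw]; exact hw a r i⟩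
    · rw [hPv]
      by_contra h
      have := (hv L₁ 0 0).mpr (not_le.mp h)
      rw [hD.2 L₁ le_rfl] at this
      exact notMem_bot _ this
    · rw [hPw]
      by_contra h
      have := (hw L₂ 0 0).mpr (not_le.mp h)
      rw [hE.2 (L₂ + 1) le_rfl] at this
      exact notMem_bot _ this
  · rintro P ⟨⟨E, D⟩, hp⟩ ⟨⟨E', D'⟩, hp'⟩ ⟨h1, h2⟩ ⟨h1', h2'⟩
    dsimp only at h1 h2 h1' h2'
    have hD : D = D' := funext fun a => SetLike.ext fun ⟨r, i⟩ => by rw [h1, h1']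
    have hE : E = E' := funext fun a => by
      rcases a with _ | a
      · rw [show E 0 = D 0 from hp.2.2, show E' 0 = D' 0 from hp'.2.2, hD]
      · exact SetLike.ext fun ⟨r, i⟩ => by rw [h2, h2']
    subst hD hE
    rfl
  · rintro ⟨P, hP⟩ ⟨P', hP'⟩ p ⟨h1, h2⟩ ⟨h1', h2'⟩
    refine Subtype.ext (ext_getD (fun r i => ?_) fun r i => ?_)
    · exact eq_of_forall_lt_iff fun a => by rw [← h1, ← h1']
    · exact eq_of_forall_lt_iff fun a => by rw [← h2, ← h2']

/-- Double counting: the boxes at distance a from the start of their row correspond to the parts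
greater than a, that is, to the cells of one level set. -/
theorem HasDiagrams.deg_eq {P : PlaneSPartition s k} {p : (ℕ → YoungDiagram) × (ℕ → YoungDiagram)}
    (h : HasDiagrams P p) {L₁ L₂ : ℕ} (hP : P.IsRestricted L₁ L₂) (N : ℕ) :
    P.deg N =
      (∑ b ∈ Finset.range L₂, (p.1 (b + 1)).card •
        Finsupp.single ((k - 1 - (b : ℤ) : ℤ) : ZMod N) 1) +
      ∑ a ∈ Finset.range L₁, (p.2 a).card • Finsupp.single ((k + (a : ℤ) : ℤ) : ZMod N) 1 := by
  rw [isRestricted_iff] at hP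
  have hv := P.isSignedArray_lam
  have hw := P.isSignedArray_mu
  obtain ⟨R, hR⟩ := P.exists_lam_eq_nil
  set M := (P.lam 0).length with hM
  have hlen : ∀ r, (P.lam r).length ≤ M := fun r => by
    rw [hM, length_le_length_iff (P.lam_partition r).1 (P.lam_partition 0).1]
    exact fun i hi => hi.trans_le (hv.le (Nat.zero_le r) le_rfl)
  have hv' : ∀ r i, 0 < (P.lam r).getD i 0 → r < R ∧ i < M := fun r i hri => by
    refine ⟨?_, ((lt_length_iff_getD_pos (P.lam_partition r).1).mpr hri).trans_le (hlen r)⟩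
    by_contra hr
    have := hv.le (not_lt.mp hr) (le_refl i)
    simp only [hR, List.getD_nil] at this
    omega
  rw [← sum_sum_sum_range_eq (M := M) h.1 hv' (fun r i =>
      (hv.le (Nat.zero_le r) (Nat.zero_le i)).trans hP.1),
    ← sum_sum_sum_range_eq (D := fun b => p.1 (b + 1)) (M := M) h.2
      (fun r i hri => hv' r i (P.lam_pos_of_mu_pos hri)) (fun r i =>
      (hw.le (Nat.zero_le r) (Nat.zero_le i)).trans hP.2), add_comm, ← Finset.sum_add_distrib, deg,
    finsum_eq_sum_of_support_subset (s := Finset.range R)]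
  · refine Finset.sum_congr rfl fun r _ => ?_
    rw [layerBoxes, list_sum_map_eq (P.lam r) _ (by simp) (hlen r),
      list_sum_map_eq (P.mu r) _ (by simp) ((P.length_mu_le r).trans (hlen r))]
  · intro r hr
    rw [Finset.coe_range, Set.mem_Iio]
    by_contra hle
    apply hr
    have h1 : P.lam r = [] := List.length_eq_zero_iff.mp (by
      by_contra h0
      have h3 := (lt_length_iff_getD_pos (P.lam_partition r).1).mp (Nat.pos_of_ne_zero h0)
      exact hle (hv' r 0 h3).1)
    have h2 : P.mu r = [] := List.length_eq_zero_iff.mp (by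
      have := P.length_mu_le r
      rw [h1] at this
      exact Nat.le_zero.mp this)
    simp [layerBoxes, h1, h2]

end PlaneSPartition

/-! ### Exchange factors with natural coefficients -/

/-- The power series `1 / (1 - z ^ d)` if `t = t'` and `1 + z ^ d` otherwise, with natural
coefficients. -/
noncomputable def natExchangeFactor (t t' : ℤˣ) (d : σ →₀ ℕ) : MvPowerSeries σ ℕ :=
  fun c => if ∃ m : ℕ, (t ≠ t' → m ≤ 1) ∧ c = m • d then 1 else 0

theorem coeff_natExchangeFactor (t t' : ℤˣ) (d c : σ →₀ ℕ) :
    coeff c (natExchangeFactor t t' d) =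
      if ∃ m : ℕ, (t ≠ t' → m ≤ 1) ∧ c = m • d then 1 else 0 := rfl

theorem nsmul_finsupp_injective {d : σ →₀ ℕ} (hd : d ≠ 0) {m n : ℕ} (h : m • d = n • d) :
    m = n := by
  obtain ⟨i, hi⟩ := Finsupp.ne_iff.mp hd
  have := DFunLike.congr_fun h i
  simp only [Finsupp.smul_apply, smul_eq_mul] at this
  exact Nat.eq_of_mul_eq_mul_right (Nat.pos_of_ne_zero hi) this

theorem exchangeFactor_monomial (t t' : ℤˣ) {d : σ →₀ ℕ} (hd : d ≠ 0) :
    exchangeFactor t t' (monomial d 1) =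
      MvPowerSeries.map (Nat.castRingHom ℝ≥0∞) (natExchangeFactor t t' d) := by
  ext c
  rw [exchangeFactor, coeff_sumAll, coeff_map, coeff_natExchangeFactor]
  simp only [monomial_pow, one_pow, coeff_monomial]
  split_ifs with h
  · obtain ⟨m, hm, rfl⟩ := h
    rw [tsum_eq_single ⟨m, hm⟩]
    · simp
    · rintro ⟨n, hn⟩ hne
      exact if_neg fun h => hne (Subtype.ext (nsmul_finsupp_injective hd h).symm)
  · rw [map_zero, ENNReal.tsum_eq_zero]
    exact fun m => if_neg fun hc => h ⟨m.1, m.2, hc⟩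

theorem map_natExchangeFactor (t t' : ℤˣ) {d : σ →₀ ℕ} (hd : d ≠ 0) :
    MvPowerSeries.map (Nat.castRingHom ℚ) (natExchangeFactor t t' d) =
      signPow (1 - (((t * t' : ℤˣ) : ℤ) : MvPowerSeries σ ℚ) * monomial d 1) (-(t * t')) := by
  by_cases h : t = t'
  · have h1 : t * t' = 1 := Int.units_mul_eq_one_iff.mpr h
    have h2 : (-1 : ℤˣ) ≠ 1 := by decide
    rw [h1, signPow, if_neg h2, Units.val_one, Int.cast_one, one_mul,
      MvPowerSeries.eq_inv_iff_mul_eq_one]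
    · rw [mul_comm, sub_mul, one_mul]
      ext c
      rw [map_sub, coeff_monomial_mul, coeff_map, coeff_map, coeff_natExchangeFactor,
        coeff_natExchangeFactor, coeff_one]
      simp only [ne_eq, h, not_true_eq_false, false_imp_iff, true_and, one_mul]
      by_cases hc : c = 0
      · subst hc
        have hdc : ¬ d ≤ 0 := fun h => hd (le_antisymm h zero_le)
        rw [if_pos ⟨0, by simp⟩, if_neg hdc]
        simp
      · rw [if_neg hc]
        -- Multiplying the geometric series by z^d shifts it by one term, so every coefficient of
        -- the difference cancels except at c = 0.
        have key : (∃ m : ℕ, c = m • d) ↔ d ≤ c ∧ ∃ m : ℕ, c - d = m • d := by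
          constructor
          · rintro ⟨m, rfl⟩
            obtain _ | m := m
            · simp at hc
            · rw [succ_nsmul]
              exact ⟨le_add_self, m, add_tsub_cancel_right _ _⟩
          · rintro ⟨hdc, m, hm⟩
            exact ⟨m + 1, by rw [succ_nsmul, ← hm, tsub_add_cancel_of_le hdc]⟩
        by_cases hdc : d ≤ c
        · rw [if_pos hdc]
          simp only [key, hdc, true_and, sub_self]
        · rw [if_neg hdc, if_neg fun hm => hdc (key.mp hm).1]
          simp
    · rw [map_sub, map_one, ← coeff_zero_eq_constantCoeff_apply, coeff_monomial, if_neg hd.symm]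
      simp
  · have h1 : t * t' = -1 := (Int.units_eq_one_or _).resolve_left
      fun h' => h (Int.units_mul_eq_one_iff.mp h')
    rw [h1, signPow, neg_neg, if_pos rfl]
    ext c
    rw [coeff_map, coeff_natExchangeFactor, Units.val_neg, Units.val_one, Int.cast_neg,
      Int.cast_one, neg_mul, one_mul, sub_neg_eq_add, map_add, coeff_one, coeff_monomial]
    have key : (∃ m : ℕ, (t ≠ t' → m ≤ 1) ∧ c = m • d) ↔ c = 0 ∨ c = d := by
      constructor
      · rintro ⟨m, hm, rfl⟩
        have := hm h
        interval_cases m <;> simp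
      · rintro (rfl | rfl)
        · exact ⟨0, by simp⟩
        · exact ⟨1, by simp⟩
    simp only [key]
    by_cases hc : c = 0
    · subst hc
      simp [hd.symm]
    · simp only [hc, false_or, if_false, zero_add]
      split_ifs <;> simp

theorem coeff_sumAll_monomial {ι : Type*} (w : ι → σ →₀ ℕ) (c : σ →₀ ℕ) :
    coeff c (sumAll fun i => monomial (w i) (1 : ℝ≥0∞)) = ({i | w i = c}.encard : ℝ≥0∞) := by
  rw [coeff_sumAll, ← ENNReal.tsum_set_one, tsum_subtype {i | w i = c} fun _ => (1 : ℝ≥0∞)]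
  refine tsum_congr fun i => ?_
  simp only [coeff_monomial, Set.indicator, Set.mem_ofPred_eq, eq_comm]

/-! ### Reindexing of intervals, root signs and root monomials -/

theorem Int.prod_Icc_add_nat {A : Type*} [CommMonoid A] (a : ℤ) (n : ℕ) (f : ℤ → A) :
    ∏ i ∈ Finset.Icc a (a + n - 1), f i = ∏ i ∈ Finset.range n, f (a + i) := by
  refine Finset.prod_nbij' (fun i => (i - a).toNat) (fun i => a + i) ?_ ?_ ?_ ?_ ?_ <;>
    simp only [Finset.mem_Icc, Finset.mem_range]
  · intro i hi
    omega
  · intro i hi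
    omega
  · intro i hi
    omega
  · intro i hi
    omega
  · intro i hi
    congr 1
    omega

theorem Int.prod_Icc_sub_nat {A : Type*} [CommMonoid A] (a : ℤ) (n : ℕ) (f : ℤ → A) :
    ∏ i ∈ Finset.Icc (a - n) a, f i = ∏ i ∈ Finset.range (n + 1), f (a - i) := by
  rw [← Finset.prod_range_reflect]
  have := Int.prod_Icc_add_nat (a - n) (n + 1) f
  rw [show a - n + ((n + 1 : ℕ) : ℤ) - 1 = a by push_cast; ring] at this
  rw [this]
  refine Finset.prod_congr rfl fun i hi => ?_
  rw [Finset.mem_range] at hi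
  congr 1
  omega

theorem Int.sum_Icc_sub_add {A : Type*} [AddCommMonoid A] (k : ℤ) (m n : ℕ) (f : ℤ → A) :
    ∑ i ∈ Finset.Icc (k - m) (k + n), f i =
      (∑ i ∈ Finset.range m, f (k - 1 - i)) + ∑ i ∈ Finset.range (n + 1), f (k + i) := by
  have h1 := Int.prod_Icc_add_nat (A := Multiplicative A) (k - m) (m + (n + 1))
    fun i => Multiplicative.ofAdd (f i)
  rw [Finset.prod_range_add, ← Finset.prod_range_reflect _ m] at h1
  have h2 : k - m + ((m + (n + 1) : ℕ) : ℤ) - 1 = k + n := by push_cast; ring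
  rw [h2] at h1
  refine (congrArg Multiplicative.toAdd h1).trans ?_
  simp only [toAdd_mul, toAdd_prod, toAdd_ofAdd]
  congr 1
  · refine Finset.sum_congr rfl fun i hi => ?_
    rw [Finset.mem_range] at hi
    congr 1
    omega
  · refine Finset.sum_congr rfl fun i _ => ?_
    congr 1
    push_cast
    ring

theorem neg_one_zpow_nodeParity (s : ℤ → ℤˣ) (i : ℤ) :
    (-1 : ℤˣ) ^ nodeParity s i = s i * s (i + 1) := by
  unfold nodeParity
  rcases Int.units_eq_one_or (s i) with h | h <;>
    rcases Int.units_eq_one_or (s (i + 1)) with h' | h' <;> rw [h, h'] <;> decide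

/-- Each (-1)^|t| equals s_t s_{t+1}, so the product telescopes. -/
theorem rootSign_eq (s : ℤ → ℤˣ) (i : ℤ) (n : ℕ) :
    rootSign s i (i + n) = s i * s (i + n + 1) := by
  unfold rootSign
  induction n with
  | zero => simp [neg_one_zpow_nodeParity]
  | succ n ih =>
    have h : Finset.Icc i (i + ((n + 1 : ℕ) : ℤ)) =
        insert (i + n + 1) (Finset.Icc i (i + n)) := by
      ext t
      simp only [Finset.mem_insert, Finset.mem_Icc]
      omega
    rw [h, Finset.sum_insert (by simp), zpow_add, ih, neg_one_zpow_nodeParity]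
    rw [show i + ((n + 1 : ℕ) : ℤ) + 1 = i + n + 1 + 1 by push_cast; ring]
    generalize s (i + n + 1) = a, s (i + n + 1 + 1) = b, s i = c
    revert a b c
    decide

theorem zRoot_eq (N : ℕ) (i j : ℤ) :
    zRoot N i j = monomial (∑ t ∈ Finset.Icc i j, Finsupp.single (t : ZMod N) 1) 1 := by
  simp only [zRoot, X, prod_monomial, Finset.prod_const_one]

/-- Color k always occurs. A non-zero exponent makes the powers in a geometric factor distinct,
which keeps its coefficients finite. -/
theorem sum_single_Icc_ne_zero (N : ℕ) (k : ℤ) (i j : ℕ) :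
    ∑ t ∈ Finset.Icc (k - i) (k + j), Finsupp.single (t : ZMod N) 1 ≠ 0 := by
  intro h0
  rw [Finset.sum_eq_zero_iff] at h0
  have := h0 k (by simp)
  simp at this

/-! ### Counting restricted plane s-partitions -/

theorem coeff_restricted (N : ℕ) (s : ℤ → ℤˣ) (k : ℤ) (L₁ L₂ : ℕ) (c : ZMod N →₀ ℕ) :
    ((restrictedOfDegree N s k L₁ L₂ c).encard : ℝ≥0∞) =
      ((coeff c (∏ j ∈ Finset.range L₁, ∏ i ∈ Finset.range (L₂ + 1),
        natExchangeFactor (s (k + ((j + 1 : ℕ) : ℤ)) * s k) (s (k - (i : ℤ)) * s k)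
          (∑ t ∈ Finset.Icc (k - i) (k + j), Finsupp.single (t : ZMod N) 1)) : ℕ) : ℝ≥0∞) := by
  obtain ⟨Φ, hΦ⟩ := PlaneSPartition.exists_equiv_chainPair s k L₁ L₂
  -- The linking step has exponent 0, since its starting diagram is the common one, whose boxes of
  -- color k are already counted by `f 0`.
  let e : ℕ → ZMod N →₀ ℕ := fun b =>
    Nat.casesOn b 0 fun b => Finsupp.single ((k - 1 - (b : ℤ) : ℤ) : ZMod N) 1
  let f : ℕ → ZMod N →₀ ℕ := fun a => Finsupp.single ((k + (a : ℤ) : ℤ) : ZMod N) 1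
  have h := sumAll_monomial_chainPair (fun b => s (k - (b : ℤ)) * s k) (L₂ + 1)
    (fun a => s (k + ((a + 1 : ℕ) : ℤ)) * s k) L₁ e f
  have he : ∀ i j : ℕ, (∑ b ∈ Finset.range (i + 1), e b) + ∑ b ∈ Finset.range (j + 1), f b =
      ∑ t ∈ Finset.Icc (k - i) (k + j), Finsupp.single (t : ZMod N) 1 := by
    intro i j
    rw [Finset.sum_range_succ' e, show e 0 = 0 from rfl, add_zero]
    exact (Int.sum_Icc_sub_add k i j fun t => Finsupp.single (t : ZMod N) 1).symm
  have hdeg : ∀ P : {P : PlaneSPartition s k // P.IsRestricted L₁ L₂}, P.1.deg N =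
      (∑ a ∈ Finset.range (L₂ + 1), ((Φ P).1.1 a).card • e a) +
          ∑ b ∈ Finset.range L₁, ((Φ P).1.2 b).card • f b := by
    intro P
    rw [(hΦ P).deg_eq P.2 N, Finset.sum_range_succ' _ L₂, show e 0 = 0 from rfl, smul_zero,
      add_zero]
  simp only [he, exchangeFactor_monomial _ _ (sum_single_Icc_ne_zero N k _ _), ← map_prod] at h
  rw [← sumAll_equiv Φ] at h
  simp only [← hdeg] at h
  have h1 := congrArg (coeff c) h
  rw [coeff_sumAll_monomial, coeff_map] at h1
  have h2 : restrictedOfDegree N s k L₁ L₂ c = Subtype.val ''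
      {P : {P : PlaneSPartition s k // P.IsRestricted L₁ L₂} | P.1.deg N = c} := by
    ext P
    simp [restrictedOfDegree, and_comm]
  rw [h2, Subtype.val_injective.encard_image, h1]
  rfl

theorem theorem7p7 (N : ℕ) (s : ℤ → ℤˣ) (hs : ∀ i : ℤ, s (i + (N : ℤ)) = s i)
    (k : ℤ) (L₁ L₂ : ℕ) :
    (∀ c : ZMod N →₀ ℕ, (restrictedOfDegree N s k L₁ L₂ c).Finite) ∧
    restrictedGenFun N s k L₁ L₂ =
      ∏ i ∈ Finset.Icc (k - (L₂ : ℤ)) k, ∏ j ∈ Finset.Icc k (k + (L₁ : ℤ) - 1),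
        signPow (1 - ((rootSign s i j : ℤ) : MvPowerSeries (ZMod N) ℚ) * zRoot N i j)
          (-rootSign s i j) := by
  have key : ∀ c, (restrictedOfDegree N s k L₁ L₂ c).encard = _ := fun c =>
    ENat.toENNReal_inj.mp ((coeff_restricted N s k L₁ L₂ c).trans (ENat.toENNReal_coe _).symm)
  refine ⟨fun c => Set.finite_of_encard_eq_coe (key c), ?_⟩
  have hfac : ∀ i j : ℕ,
      signPow (1 - ((rootSign s (k - i) (k + j) : ℤ) : MvPowerSeries (ZMod N) ℚ) *
          zRoot N (k - i) (k + j)) (-rootSign s (k - i) (k + j)) =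
        MvPowerSeries.map (Nat.castRingHom ℚ)
          (natExchangeFactor (s (k + ((j + 1 : ℕ) : ℤ)) * s k) (s (k - (i : ℤ)) * s k)
            (∑ t ∈ Finset.Icc (k - i) (k + j), Finsupp.single (t : ZMod N) 1)) := by
    intro i j
    have hsign : rootSign s (k - i) (k + j) =
        s (k + ((j + 1 : ℕ) : ℤ)) * s k * (s (k - (i : ℤ)) * s k) := by
      have := rootSign_eq s (k - i) (i + j)
      rw [show k - i + ((i + j : ℕ) : ℤ) = k + j by push_cast; ring] at this
      rw [this, show k + ((j + 1 : ℕ) : ℤ) = k + j + 1 by push_cast; ring]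
      generalize s (k - i) = a, s (k + j + 1) = b, s k = c
      revert a b c
      decide
    rw [map_natExchangeFactor _ _ (sum_single_Icc_ne_zero N k i j), zRoot_eq, hsign]
  rw [Int.prod_Icc_sub_nat]
  simp only [Int.prod_Icc_add_nat, hfac]
  rw [Finset.prod_comm]
  simp only [← map_prod]
  ext c
  rw [coeff_map, eq_natCast]
  exact congrArg Nat.cast ((Set.ncard_def _).trans (congrArg ENat.toNat (key c)))
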